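/- Let $\mathcal C$ be a small monoidal category with tensor unit $I$. A central idempotent of $\mathcal C$ is a morphism $u\colon U\to I$ together with a half-braiding $\sigma_A\colon U\otimes A\cong A\otimes U$ ($A\in\mathcal C$) such that $(A\otimes u)\circ\sigma_A=u\otimes A$ for all $A$, $u\otimes U=U\otimes u\colon U\otimes U\to U$ (up to unitors), and this morphism is invertible. Two central idempotents $u,v$ are identified when $u=v\circ m$ for an isomorphism $m\colon U\to V$ that respects the half-braidings. The resulting set $ZI(\mathcal C)$ is partially ordered by $u\le v$ iff $u=v\circ m$ for some $m\colon U\to V$ that respects the half-braidings; it has top element $1=\mathrm{id}_I$ and meets $u\wedge v=u\otimes v$. The category $\mathcal C$ has universal finite joins of central idempotents when it has an initial object $0$ with $A\otimes 0\cong 0\cong 0\otimes A$ for all $A$, and any two central idempotents $u,v$ have a join $u\vee v$ in $ZI(\mathcal C)$ such that for every object $A$ the square $$\begin{array}{ccc}A\otimes U\otimes V&\to&A\otimes V\\ \downarrow&&\downarrow\\ A\otimes U&\to&A\otimes(U\vee V)\end{array}$$ is both a pullback and a pushout. A monoidal category $\mathcal D$ is $\vee$-local when $ZI(\mathcal D)$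 has at least two elements and $p\vee q=1$ in $ZI(\mathcal D)$ only if $p=1$ or $q=1$. For a filter $x\subseteq ZI(\mathcal C)$, the stalk $\mathcal C|_x$ is the following monoidal category. Its objects are those of $\mathcal C$. A morphism $A\to B$ is a class $[v,f]$ with $v\in x$ and $f\colon A\otimes V\to B$ in $\mathcal C$, where $[v,f]=[v',f']$ if $f$ and $f'$ agree after restriction along $U\to V$ and $U\to V'$ for some $u\in x$ with $u\le v\wedge v'$. Composition is $[v,g]\circ[u,f]=[u\wedge v,\,g\circ(f\otimes V)]$, and identities are $[1,\mathrm{id}]$. The tensor product is that of $\mathcal C$ on objects, and on morphisms is $[u,f]\otimes[v,g]=[u\wedge v,\,f\otimes g]$, precomposed with the half-braiding of $U$. **Corollary.** Let $\mathcal C$ be a small monoidal category with universal finite joins of central idempotents. 1. The tuple $\mathcal C\to\prod_x\mathcal C|_x$ of the quotient functors $A\mapsto A$, $f\mapsto[1,f]$, where $x$ ranges over the prime filters of $ZI(\mathcal C)$, is a strong monoidal faithful functor. It is injective on objects as soon as $ZI(\mathcal C)$ has at least two elements. 2. If $\mathcal C$ is braided, then each of the stalks $\mathcal C|_x$ at a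 prime filter $x$ is $\vee$-local. 3. In general, braided or not, $\mathcal C$ embeds monoidally into a product of $\vee$-local monoidal categories: there are a family $(\mathcal D_i)_{i}$ of small $\vee$-local monoidal categories and a strong monoidal functor $\mathcal C\to\prod_i\mathcal D_i$ that is faithful and injective on objects. -/

import Mathlib

open CategoryTheory MonoidalCategory

universe v u

section CentralIdempotents

variable (C : Type u) [Category.{v} C] [MonoidalCategory C]

/-- A central idempotent of `C`, as a representative: a morphism `hom : obj ⟶ 𝟙_ C` whose domain
carries a half-braiding that makes `hom` a morphism of the centre, such that
`hom ⊗ obj = obj ⊗ hom : obj ⊗ obj ⟶ obj` (up to unitors), this morphism being invertible. -/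
structure CentralIdempotent where
  obj : C
  hom : obj ⟶ 𝟙_ C
  braid : HalfBraiding obj
  hom_braid : ∀ A : C, (braid.β A).hom ≫ A ◁ hom ≫ (ρ_ A).hom = hom ▷ A ≫ (λ_ A).hom
  central : hom ▷ obj ≫ (λ_ obj).hom = obj ◁ hom ≫ (ρ_ obj).hom
  isIso_left : IsIso (hom ▷ obj ≫ (λ_ obj).hom)

end CentralIdempotents

namespace CentralIdempotent

variable {C : Type u} [Category.{v} C] [MonoidalCategory C]

attribute [instance] CentralIdempotent.isIso_left

/-- Morphisms `u ⟶ v` of central idempotents: morphisms of the domains over the unit that respect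
the half-braidings. -/
@[ext]
structure Hom (u v : CentralIdempotent C) where
  hom : u.obj ⟶ v.obj
  fac : hom ≫ v.hom = u.hom
  comm : ∀ A : C, hom ▷ A ≫ (v.braid.β A).hom = (u.braid.β A).hom ≫ A ◁ hom

/-- `u` and `v` represent the same central idempotent when there is an isomorphism of their domains
over the unit that respects the half-braidings. -/
def Equivalent (u v : CentralIdempotent C) : Prop := ∃ m : Hom u v, IsIso m.hom

lemma isIso_whiskerRight (u : CentralIdempotent C) : IsIso (u.hom ▷ u.obj) := by
  have := u.isIso_left
  exact IsIso.of_isIso_comp_right _ (λ_ u.obj).hom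

/-- Morphisms of central idempotents are unique. -/
lemma fac_unique {u v : CentralIdempotent C} (m n : u.obj ⟶ v.obj)
    (hm : m ≫ v.hom = u.hom) (hn : n ≫ v.hom = u.hom) : m = n := by
  have h1 : (m ⊗ₘ n) ≫ v.hom ▷ v.obj ≫ (λ_ v.obj).hom = (u.hom ▷ u.obj ≫ (λ_ u.obj).hom) ≫ n := by
    rw [tensorHom_def', Category.assoc, ← comp_whiskerRight_assoc, hm, whisker_exchange_assoc,
      leftUnitor_naturality, Category.assoc]
  have h2 : (m ⊗ₘ n) ≫ v.obj ◁ v.hom ≫ (ρ_ v.obj).hom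
      = (u.obj ◁ u.hom ≫ (ρ_ u.obj).hom) ≫ m := by
    rw [MonoidalCategory.tensorHom_def, Category.assoc, ← whiskerLeft_comp_assoc, hn, ← whisker_exchange_assoc,
      rightUnitor_naturality, Category.assoc]
  rw [← v.central, h1, ← u.central] at h2
  exact ((cancel_epi _).1 h2).symm

lemma isIso_hom_whiskerRight_tensor (v : CentralIdempotent C) (A : C) :
    IsIso (v.hom ▷ (A ⊗ v.obj)) := by
  have := v.isIso_whiskerRight
  have h : v.hom ▷ (A ⊗ v.obj) = (α_ _ _ _).inv ≫ ((v.braid.β A).hom ▷ v.obj) ≫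
      (α_ _ _ _).hom ≫ A ◁ (v.hom ▷ v.obj ≫ (λ_ _).hom) ≫ (λ_ (A ⊗ v.obj)).inv := by
    have := v.hom_braid A
    rw [← cancel_mono (λ_ (A ⊗ v.obj)).hom]
    calc _ = 𝟙 _ ⊗≫ (v.hom ▷ A ≫ (λ_ A).hom) ▷ v.obj ⊗≫ 𝟙 _ := by monoidal
      _ = _ := by rw [← this]; monoidal
  rw [h]; infer_instance

lemma isIso_whiskerLeft_whiskerLeft_hom (v : CentralIdempotent C) (A : C) :
    IsIso (v.obj ◁ A ◁ v.hom) := by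
  have := v.isIso_whiskerRight
  have h := v.braid.naturality (A ◁ v.hom)
  rw [← Iso.eq_comp_inv] at h
  rw [h, whisker_assoc]; infer_instance

/-- A morphism over the unit automatically respects the half-braidings. -/
def Hom.ofFac {u v : CentralIdempotent C} (m : u.obj ⟶ v.obj) (hm : m ≫ v.hom = u.hom) :
    Hom u v where
  hom := m
  fac := hm
  comm A := by
    have h0 : (m ▷ A ≫ (v.braid.β A).hom) ≫ A ◁ v.hom
        = ((u.braid.β A).hom ≫ A ◁ m) ≫ A ◁ v.hom := by
      rw [← cancel_mono (ρ_ A).hom]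
      simp only [Category.assoc, v.hom_braid, ← whiskerLeft_comp_assoc, hm, u.hom_braid,
        ← comp_whiskerRight_assoc]
    have h1 : v.obj ◁ (m ▷ A ≫ (v.braid.β A).hom) = v.obj ◁ ((u.braid.β A).hom ≫ A ◁ m) := by
      have := v.isIso_whiskerLeft_whiskerLeft_hom A
      rw [← cancel_mono (v.obj ◁ A ◁ v.hom), ← whiskerLeft_comp, h0, whiskerLeft_comp]
    have h2 : IsIso (u.hom ▷ (u.obj ⊗ A)) := by
      have := u.isIso_whiskerRight
      rw [whiskerRight_tensor]; infer_instance
    have h3 : v.hom ▷ (u.obj ⊗ A) ≫ 𝟙_ C ◁ (m ▷ A ≫ (v.braid.β A).hom)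
        = v.hom ▷ (u.obj ⊗ A) ≫ 𝟙_ C ◁ ((u.braid.β A).hom ≫ A ◁ m) := by
      rw [← whisker_exchange, h1, whisker_exchange]
    have h4 : u.hom ▷ (u.obj ⊗ A) ≫ 𝟙_ C ◁ (m ▷ A ≫ (v.braid.β A).hom)
        = u.hom ▷ (u.obj ⊗ A) ≫ 𝟙_ C ◁ ((u.braid.β A).hom ≫ A ◁ m) := by
      rw [← hm, comp_whiskerRight, Category.assoc, h3, Category.assoc]
    have h5 := (cancel_epi _).1 h4
    rwa [id_whiskerLeft, id_whiskerLeft, cancel_epi, cancel_mono] at h5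

def Hom.id (u : CentralIdempotent C) : Hom u u := .ofFac (𝟙 _) (by simp)

def Hom.comp {u v w : CentralIdempotent C} (m : Hom u v) (n : Hom v w) : Hom u w :=
  .ofFac (m.hom ≫ n.hom) (by rw [Category.assoc, n.fac, m.fac])

lemma isIso_of_hom_hom {u v : CentralIdempotent C} (m : Hom u v) (n : Hom v u) : IsIso m.hom :=
  ⟨n.hom, fac_unique _ _ (by rw [Category.assoc, n.fac, m.fac]) (by simp),
    fac_unique _ _ (by rw [Category.assoc, m.fac, n.fac]) (by simp)⟩

lemma equivalent_iff {u v : CentralIdempotent C} :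
    Equivalent u v ↔ Nonempty (Hom u v) ∧ Nonempty (Hom v u) := by
  constructor
  · rintro ⟨m, hm⟩
    exact ⟨⟨m⟩, ⟨.ofFac (inv m.hom) (by rw [← m.fac, IsIso.inv_hom_id_assoc])⟩⟩
  · rintro ⟨⟨m⟩, ⟨n⟩⟩
    exact ⟨m, isIso_of_hom_hom m n⟩

variable (C) in
def setoid : Setoid (CentralIdempotent C) where
  r := Equivalent
  iseqv :=
    { refl := fun u => equivalent_iff.2 ⟨⟨.id u⟩, ⟨.id u⟩⟩
      symm := fun h => equivalent_iff.2 (equivalent_iff.1 h).symm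
      trans := fun h k => by
        obtain ⟨⟨a⟩, ⟨b⟩⟩ := equivalent_iff.1 h
        obtain ⟨⟨c⟩, ⟨d⟩⟩ := equivalent_iff.1 k
        exact equivalent_iff.2 ⟨⟨a.comp c⟩, ⟨d.comp b⟩⟩ }

lemma braid_unit (v : CentralIdempotent C) :
    (v.braid.β (𝟙_ C)).hom = (ρ_ v.obj).hom ≫ (λ_ v.obj).inv := by
  have h1 := v.braid.monoidal (𝟙_ C) (𝟙_ C)
  have h2 := v.braid.naturality (λ_ (𝟙_ C)).hom
  obtain ⟨c, hc⟩ : ∃ c : v.obj ≅ v.obj,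
      (v.braid.β (𝟙_ C)).hom = (ρ_ v.obj).hom ≫ c.hom ≫ (λ_ v.obj).inv :=
    ⟨(ρ_ _).symm ≪≫ v.braid.β (𝟙_ C) ≪≫ λ_ _, by simp⟩
  rw [h1, hc] at h2
  have h3 : c.hom = c.hom ≫ c.hom := by
    calc c.hom = 𝟙 _ ⊗≫ (v.obj ◁ (λ_ (𝟙_ C)).hom ≫ (ρ_ v.obj).hom ≫ c.hom ≫ (λ_ v.obj).inv) ⊗≫
          𝟙 _ := by monoidal
      _ = _ := by rw [h2]; monoidal
  have h4 : c.hom = 𝟙 _ := by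
    have h5 : c.hom ≫ 𝟙 _ = c.hom ≫ c.hom := by rw [Category.comp_id]; exact h3
    exact ((cancel_epi _).1 h5).symm
  rw [hc, h4, Category.id_comp]

lemma hom_braid' (v : CentralIdempotent C) {A : C} (a : A ⟶ 𝟙_ C) :
    (v.braid.β A).hom ≫ a ▷ v.obj ≫ (λ_ v.obj).hom = v.obj ◁ a ≫ (ρ_ v.obj).hom := by
  rw [← v.braid.naturality_assoc, braid_unit, Category.assoc, Iso.inv_hom_id, Category.comp_id]

/-- The unit, as a central idempotent. -/
abbrev unit : CentralIdempotent C where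
  obj := 𝟙_ C
  hom := 𝟙 _
  braid := Center.tensorUnit.2
  hom_braid A := by simp [Center.tensorUnit]
  central := by simp [unitors_equal]
  isIso_left := by infer_instance

/-- The meet of central idempotents is their tensor product. -/
abbrev tensor (u v : CentralIdempotent C) : CentralIdempotent C where
  obj := u.obj ⊗ v.obj
  hom := (u.hom ⊗ₘ v.hom) ≫ (λ_ (𝟙_ C)).hom
  braid := (Center.tensorObj ⟨u.obj, u.braid⟩ ⟨v.obj, v.braid⟩).2
  hom_braid A := by
    simp only [Center.tensorObj, Iso.trans_hom, whiskerLeftIso_hom, Iso.symm_hom, whiskerRightIso_hom]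
    have hu := u.hom_braid A
    have hv := v.hom_braid A
    calc _ = 𝟙 _ ⊗≫ u.obj ◁ (v.braid.β A).hom ⊗≫ (u.braid.β A).hom ▷ v.obj ⊗≫
          A ◁ (u.hom ⊗ₘ v.hom) ⊗≫ 𝟙 _ := by monoidal
      _ = 𝟙 _ ⊗≫ u.obj ◁ (v.braid.β A).hom ⊗≫ ((u.braid.β A).hom ≫ A ◁ u.hom ≫ (ρ_ A).hom) ▷ v.obj ⊗≫
          A ◁ v.hom ⊗≫ 𝟙 _ := by rw [MonoidalCategory.tensorHom_def]; monoidal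
      _ = 𝟙 _ ⊗≫ u.obj ◁ (v.braid.β A).hom ⊗≫ (u.hom ▷ (A ⊗ v.obj) ≫ 𝟙_ C ◁ (A ◁ v.hom)) ⊗≫ 𝟙 _ := by
        rw [hu]; monoidal
      _ = 𝟙 _ ⊗≫ u.obj ◁ ((v.braid.β A).hom ≫ A ◁ v.hom ≫ (ρ_ A).hom) ⊗≫ u.hom ▷ A ⊗≫ 𝟙 _ := by
        rw [← whisker_exchange]; monoidal
      _ = 𝟙 _ ⊗≫ (u.obj ◁ v.hom ≫ u.hom ▷ _) ▷ A ⊗≫ 𝟙 _ := by rw [hv]; monoidal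
      _ = _ := by rw [← tensorHom_def']; monoidal
  central := by
    have hb := v.hom_braid u.obj
    calc _ = 𝟙 _ ⊗≫ u.obj ◁ (v.hom ▷ u.obj ≫ (λ_ _).hom) ▷ v.obj ⊗≫
          (u.hom ▷ u.obj) ▷ v.obj ⊗≫ 𝟙 _ := by rw [tensorHom_def']; monoidal
      _ = 𝟙 _ ⊗≫ u.obj ◁ (v.braid.β u.obj).hom ▷ v.obj ⊗≫
          (u.obj ⊗ u.obj) ◁ (v.hom ▷ v.obj ≫ (λ_ _).hom) ⊗≫
          (u.hom ▷ u.obj ≫ (λ_ _).hom) ▷ v.obj ⊗≫ 𝟙 _ := by rw [← hb]; monoidal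
      _ = 𝟙 _ ⊗≫ u.obj ◁ ((v.braid.β u.obj).hom ▷ v.obj ≫ (u.obj ⊗ v.obj) ◁ v.hom) ⊗≫
          u.obj ◁ u.hom ▷ v.obj ⊗≫ 𝟙 _ := by rw [u.central, v.central]; monoidal
      _ = 𝟙 _ ⊗≫ u.obj ◁ ((v.obj ⊗ u.obj) ◁ v.hom) ⊗≫
          u.obj ◁ ((v.braid.β u.obj).hom ≫ u.hom ▷ v.obj ≫ (λ_ _).hom) ⊗≫ 𝟙 _ := by
        rw [← whisker_exchange]; monoidal
      _ = _ := by rw [hom_braid', tensorHom_def']; monoidal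
  isIso_left := by
    have h : ((u.hom ⊗ₘ v.hom) ≫ (λ_ (𝟙_ C)).hom) ▷ (u.obj ⊗ v.obj) ≫ (λ_ (u.obj ⊗ v.obj)).hom
        = (α_ _ _ _).hom ≫ u.obj ◁ (v.hom ▷ (u.obj ⊗ v.obj) ≫ (λ_ _).hom) ≫
          (α_ _ _ _).inv ≫ (u.hom ▷ u.obj ≫ (λ_ _).hom) ▷ v.obj := by
      rw [tensorHom_def']; monoidal
    have := v.isIso_hom_whiskerRight_tensor u.obj
    rw [h]; infer_instance


def tensorFst (u v : CentralIdempotent C) : Hom (u.tensor v) u :=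
  .ofFac (u.obj ◁ v.hom ≫ (ρ_ _).hom) (by
    change (u.obj ◁ v.hom ≫ (ρ_ u.obj).hom) ≫ u.hom = (u.hom ⊗ₘ v.hom) ≫ (λ_ (𝟙_ C)).hom
    rw [tensorHom_def', Category.assoc, Category.assoc, unitors_equal, rightUnitor_naturality])

def tensorSnd (u v : CentralIdempotent C) : Hom (u.tensor v) v :=
  .ofFac (u.hom ▷ v.obj ≫ (λ_ _).hom) (by
    change (u.hom ▷ v.obj ≫ (λ_ v.obj).hom) ≫ v.hom = (u.hom ⊗ₘ v.hom) ≫ (λ_ (𝟙_ C)).hom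
    rw [MonoidalCategory.tensorHom_def, Category.assoc, Category.assoc, leftUnitor_naturality])

def Hom.tensor {u u' v v' : CentralIdempotent C} (m : Hom u u') (n : Hom v v') :
    Hom (u.tensor v) (u'.tensor v') :=
  .ofFac (m.hom ⊗ₘ n.hom) (by
    change (m.hom ⊗ₘ n.hom) ≫ (u'.hom ⊗ₘ v'.hom) ≫ (λ_ (𝟙_ C)).hom
      = (u.hom ⊗ₘ v.hom) ≫ (λ_ (𝟙_ C)).hom
    rw [tensorHom_comp_tensorHom_assoc, m.fac, n.fac])

noncomputable def Hom.lift {w u v : CentralIdempotent C} (m : Hom w u) (n : Hom w v) :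
    Hom w (u.tensor v) :=
  .ofFac (inv (w.hom ▷ w.obj ≫ (λ_ w.obj).hom) ≫ (m.hom ⊗ₘ n.hom)) (by
    change _ ≫ (u.hom ⊗ₘ v.hom) ≫ (λ_ (𝟙_ C)).hom = w.hom
    rw [Category.assoc, tensorHom_comp_tensorHom_assoc, m.fac, n.fac, IsIso.inv_comp_eq,
      MonoidalCategory.tensorHom_def, Category.assoc, Category.assoc, leftUnitor_naturality])

def toUnit (u : CentralIdempotent C) : Hom u unit := .ofFac u.hom (Category.comp_id _)

end CentralIdempotent

section ZI

variable (C : Type u) [Category.{v} C] [MonoidalCategory C]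

/-- The set `ZI(C)` of central idempotents of `C`. -/
def ZI : Type (max u v) := Quotient (CentralIdempotent.setoid C)

variable {C}

/-- The central idempotent represented by `u`. -/
def CentralIdempotent.toZI (u : CentralIdempotent C) : ZI C := Quotient.mk _ u

open CentralIdempotent

/-- `u ≤ v` when `u` factors through `v` via a morphism that respects the half-braidings. -/
instance : LE (ZI C) where
  le := Quotient.lift₂ (fun u v => Nonempty (Hom u v)) (by
    intro a b a' b' h k
    obtain ⟨⟨h1⟩, ⟨h2⟩⟩ := equivalent_iff.1 h
    obtain ⟨⟨k1⟩, ⟨k2⟩⟩ := equivalent_iff.1 k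
    exact propext ⟨fun ⟨m⟩ => ⟨(h2.comp m).comp k1⟩, fun ⟨m⟩ => ⟨(h1.comp m).comp k2⟩⟩)

lemma toZI_le_toZI {u v : CentralIdempotent C} : u.toZI ≤ v.toZI ↔ Nonempty (Hom u v) := Iff.rfl

instance : PartialOrder (ZI C) where
  le_refl := by rintro ⟨u⟩; exact ⟨.id u⟩
  le_trans := by rintro ⟨u⟩ ⟨v⟩ ⟨w⟩ ⟨m⟩ ⟨n⟩; exact ⟨m.comp n⟩
  le_antisymm := by rintro ⟨u⟩ ⟨v⟩ h k; exact Quotient.sound (equivalent_iff.2 ⟨h, k⟩)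

instance : OrderTop (ZI C) where
  top := unit.toZI
  le_top := by rintro ⟨u⟩; exact ⟨u.toUnit⟩

lemma CentralIdempotent.unit_mem (x : Order.PFilter (ZI C)) : (unit : CentralIdempotent C).toZI ∈ x :=
  Order.PFilter.top_mem

lemma CentralIdempotent.tensor_mem {x : Order.PFilter (ZI C)} {u v : CentralIdempotent C}
    (hu : u.toZI ∈ x) (hv : v.toZI ∈ x) : (u.tensor v).toZI ∈ x := by
  obtain ⟨w, hw, h1, h2⟩ := x.directed _ hu _ hv
  refine Order.PFilter.mem_of_le ?_ hw
  induction w using Quotient.inductionOn with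
  | h w =>
    obtain ⟨m⟩ := h1
    obtain ⟨n⟩ := h2
    exact ⟨m.lift n⟩

end ZI

section Stalk

variable {C : Type u} [Category.{v} C] [MonoidalCategory C]

open CentralIdempotent

/-- A representative of a morphism `A ⟶ B` of the stalk at the filter `x`: a central idempotent in
`x` together with a morphism `A ⊗ idem ⟶ B` of `C`. -/
structure Germ (x : Order.PFilter (ZI C)) (A B : C) where
  idem : CentralIdempotent C
  mem : idem.toZI ∈ x
  map : A ⊗ idem.obj ⟶ B

/-- Two representatives are identified when they agree on some central idempotent in `x` that lies
below both. -/
def Germ.Rel {x : Order.PFilter (ZI C)} {A B : C} (r s : Germ x A B) : Prop :=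
  ∃ (w : CentralIdempotent C) (_ : w.toZI ∈ x) (m : Hom w r.idem) (n : Hom w s.idem),
    A ◁ m.hom ≫ r.map = A ◁ n.hom ≫ s.map

def Germ.setoid (x : Order.PFilter (ZI C)) (A B : C) : Setoid (Germ x A B) where
  r := Germ.Rel
  iseqv :=
    { refl := fun r => ⟨r.idem, r.mem, .id _, .id _, rfl⟩
      symm := fun ⟨w, hw, m, n, h⟩ => ⟨w, hw, n, m, h.symm⟩
      trans := by
        rintro r s t ⟨w, hw, m, n, h⟩ ⟨z, hz, k, l, h'⟩
        refine ⟨w.tensor z, tensor_mem hw hz, (w.tensorFst z).comp m, (w.tensorSnd z).comp l, ?_⟩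
        have e : (w.tensorFst z).hom ≫ n.hom = (w.tensorSnd z).hom ≫ k.hom :=
          fac_unique _ _ ((w.tensorFst z).comp n).fac ((w.tensorSnd z).comp k).fac
        change A ◁ ((w.tensorFst z).hom ≫ m.hom) ≫ _ = A ◁ ((w.tensorSnd z).hom ≫ l.hom) ≫ _
        rw [whiskerLeft_comp, whiskerLeft_comp, Category.assoc, Category.assoc, h, ← h',
          ← whiskerLeft_comp_assoc, ← whiskerLeft_comp_assoc, e] }

/-- The stalk of `C` at a filter `x` of central idempotents. Its objects are those of `C`. -/
structure Stalk (x : Order.PFilter (ZI C)) : Type u where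
  obj : C

namespace Stalk

variable {x : Order.PFilter (ZI C)}

/-- Morphisms of the stalk are germs of morphisms of `C`. -/
instance : Quiver (Stalk x) where
  Hom X Y := Quotient (Germ.setoid x X.obj Y.obj)

/-- The morphism `[v, f]` of the stalk. -/
def germ (v : CentralIdempotent C) (hv : v.toZI ∈ x) {X Y : Stalk x}
    (f : X.obj ⊗ v.obj ⟶ Y.obj) : X ⟶ Y :=
  Quotient.mk (Germ.setoid x X.obj Y.obj) ⟨v, hv, f⟩

lemma ind {X Y : Stalk x} {P : (X ⟶ Y) → Prop} (h : ∀ v hv f, P (germ v hv f)) (φ : X ⟶ Y) :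
    P φ :=
  Quotient.inductionOn φ fun r => h r.idem r.mem r.map

lemma germ_eq {X Y : Stalk x} {v w z : CentralIdempotent C} {hv : v.toZI ∈ x} {hw : w.toZI ∈ x}
    {f : X.obj ⊗ v.obj ⟶ Y.obj} {g : X.obj ⊗ w.obj ⟶ Y.obj} (hz : z.toZI ∈ x)
    (m : Hom z v) (n : Hom z w)
    (h : X.obj ◁ m.hom ≫ f = X.obj ◁ n.hom ≫ g) : germ v hv f = germ w hw g :=
  Quotient.sound ⟨z, hz, m, n, h⟩

lemma germ_res {X Y : Stalk x} {v z : CentralIdempotent C} {hv : v.toZI ∈ x}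
    (hz : z.toZI ∈ x) {f : X.obj ⊗ v.obj ⟶ Y.obj} (m : Hom z v) (f' : X.obj ⊗ z.obj ⟶ Y.obj)
    (h : X.obj ◁ m.hom ≫ f = f') : germ v hv f = germ z hz f' :=
  germ_eq hz m (.id z) (by rw [h]; change _ = X.obj ◁ (𝟙 _) ≫ _; simp)

/-- `[u, f] ≫ [v, g] = [u ∧ v, (f ⊗ v) ≫ g]`, and the identity is `[1, 𝟙]`. -/
instance : CategoryStruct (Stalk x) where
  id X := germ unit (unit_mem x) (ρ_ X.obj).hom
  comp {X Y Z} := Quotient.map₂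
    (fun r s => ⟨r.idem.tensor s.idem, tensor_mem r.mem s.mem,
      (α_ X.obj r.idem.obj s.idem.obj).inv ≫ r.map ▷ s.idem.obj ≫ s.map⟩)
    (by
      rintro r r' ⟨w, hw, m, n, h⟩ s s' ⟨z, hz, k, l, h'⟩
      refine ⟨w.tensor z, tensor_mem hw hz, m.tensor k, n.tensor l, ?_⟩
      change X.obj ◁ (m.hom ⊗ₘ k.hom) ≫ (α_ X.obj r.idem.obj s.idem.obj).inv ≫
        r.map ▷ s.idem.obj ≫ s.map = X.obj ◁ (n.hom ⊗ₘ l.hom) ≫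
        (α_ X.obj r'.idem.obj s'.idem.obj).inv ≫ r'.map ▷ s'.idem.obj ≫ s'.map
      have key : ∀ {a b : C} (m : w.obj ⟶ a) (k : z.obj ⟶ b) (f : X.obj ⊗ a ⟶ Y.obj)
          (g : Y.obj ⊗ b ⟶ Z.obj), X.obj ◁ (m ⊗ₘ k) ≫ (α_ X.obj a b).inv ≫ f ▷ b ≫ g =
            (α_ _ _ _).inv ≫ (X.obj ◁ m ≫ f) ▷ z.obj ≫ Y.obj ◁ k ≫ g := by
        intro a b m k f g
        calc _ = 𝟙 _ ⊗≫ X.obj ◁ m ▷ z.obj ⊗≫ ((X.obj ⊗ a) ◁ k ≫ f ▷ b) ≫ g := by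
              rw [MonoidalCategory.tensorHom_def]; monoidal
          _ = _ := by rw [whisker_exchange]; monoidal
      rw [key, key, h, h'])

lemma id_def (X : Stalk x) : 𝟙 X = germ unit (unit_mem x) (ρ_ X.obj).hom := rfl

lemma germ_comp_germ {X Y Z : Stalk x} {u v : CentralIdempotent C} {hu : u.toZI ∈ x}
    {hv : v.toZI ∈ x} (f : X.obj ⊗ u.obj ⟶ Y.obj) (g : Y.obj ⊗ v.obj ⟶ Z.obj) :
    germ u hu f ≫ germ v hv g = germ (u.tensor v) (tensor_mem hu hv)
      ((α_ X.obj u.obj v.obj).inv ≫ f ▷ v.obj ≫ g) := rfl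

instance : Category (Stalk x) where
  id_comp := by
    intro X Y φ
    induction φ using ind with | h v hv f =>
    rw [id_def, germ_comp_germ]
    refine (germ_res _ (unit.tensorSnd v) _ ?_).symm
    change X.obj ◁ (𝟙 (𝟙_ C) ▷ v.obj ≫ (λ_ v.obj).hom) ≫ f
      = (α_ X.obj (𝟙_ C) v.obj).inv ≫ (ρ_ X.obj).hom ▷ v.obj ≫ f
    simp
  comp_id := by
    intro X Y φ
    induction φ using ind with | h v hv f =>
    rw [id_def, germ_comp_germ]
    refine (germ_res _ (v.tensorFst unit) _ ?_).symm
    change X.obj ◁ (v.obj ◁ 𝟙 (𝟙_ C) ≫ (ρ_ v.obj).hom) ≫ f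
      = (α_ X.obj v.obj (𝟙_ C)).inv ≫ f ▷ 𝟙_ C ≫ (ρ_ Y.obj).hom
    simp
  assoc := by
    intro X Y Z W φ ψ χ
    induction φ using ind with | h u hu f =>
    induction ψ using ind with | h v hv g =>
    induction χ using ind with | h w hw k =>
    simp only [germ_comp_germ]
    refine (germ_res _ (.ofFac (α_ u.obj v.obj w.obj).hom ?_) _ ?_).symm
    · change (α_ u.obj v.obj w.obj).hom ≫
        (u.hom ⊗ₘ ((v.hom ⊗ₘ w.hom) ≫ (λ_ (𝟙_ C)).hom)) ≫ (λ_ (𝟙_ C)).hom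
        = (((u.hom ⊗ₘ v.hom) ≫ (λ_ (𝟙_ C)).hom) ⊗ₘ w.hom) ≫ (λ_ (𝟙_ C)).hom
      simp only [MonoidalCategory.tensorHom_def]
      monoidal
    · change X.obj ◁ (α_ u.obj v.obj w.obj).hom ≫ (α_ X.obj u.obj (v.obj ⊗ w.obj)).inv ≫
        f ▷ (v.obj ⊗ w.obj) ≫ (α_ Y.obj v.obj w.obj).inv ≫ g ▷ w.obj ≫ k =
        (α_ X.obj (u.obj ⊗ v.obj) w.obj).inv ≫
          ((α_ X.obj u.obj v.obj).inv ≫ f ▷ v.obj ≫ g) ▷ w.obj ≫ k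
      monoidal


variable (x) in
/-- The quotient functor from `C` to its stalk at `x`, `f ↦ [1, f]`. -/
abbrev toStalk : C ⥤ Stalk x where
  obj A := ⟨A⟩
  map {A B} f := germ (X := ⟨A⟩) (Y := ⟨B⟩) unit (unit_mem x) ((ρ_ A).hom ≫ f)
  map_id A := by rw [Category.comp_id]; rfl
  map_comp {A B D} f g := by
    rw [germ_comp_germ]
    refine germ_eq (tensor_mem (unit_mem x) (unit_mem x)) (unit.tensorFst unit) (.id _) ?_
    change A ◁ (𝟙_ C ◁ 𝟙 (𝟙_ C) ≫ (ρ_ _).hom) ≫ (ρ_ A).hom ≫ f ≫ g = A ◁ 𝟙 _ ≫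
      (α_ A (𝟙_ C) (𝟙_ C)).inv ≫ ((ρ_ A).hom ≫ f) ▷ 𝟙_ C ≫ (ρ_ B).hom ≫ g
    simp only [whiskerLeft_id, Category.id_comp]
    monoidal

/-- The morphism `A ⊗ v ⟶ A` of `C`; it becomes invertible in the stalks at filters that
contain `v`. -/
def counit (A : C) (v : CentralIdempotent C) : A ⊗ v.obj ⟶ A := A ◁ v.hom ≫ (ρ_ A).hom

lemma toStalk_counit_comp_germ {X Y : Stalk x} (v : CentralIdempotent C) (hv : v.toZI ∈ x)
    (f : X.obj ⊗ v.obj ⟶ Y.obj) :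
    (toStalk x).map (counit X.obj v) ≫ germ v hv f = (toStalk x).map f := by
  change germ (unit.tensor v) _ ((α_ (X.obj ⊗ v.obj) (𝟙_ C) v.obj).inv ≫
    ((ρ_ (X.obj ⊗ v.obj)).hom ≫ counit X.obj v) ▷ v.obj ≫ f) =
      germ unit _ ((ρ_ (X.obj ⊗ v.obj)).hom ≫ f)
  refine germ_eq (tensor_mem (unit_mem x) hv) (.id _) (tensorFst _ _) ?_
  change (X.obj ⊗ v.obj) ◁ (𝟙 _) ≫ _ =
    (X.obj ⊗ v.obj) ◁ (𝟙_ C ◁ v.hom ≫ (ρ_ (𝟙_ C)).hom) ≫ (ρ_ (X.obj ⊗ v.obj)).hom ≫ f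
  have h := v.central
  calc _ = 𝟙 _ ⊗≫ X.obj ◁ (v.hom ▷ v.obj ≫ (λ_ _).hom) ⊗≫ f := by
        rw [counit]; monoidal
    _ = _ := by rw [h]; monoidal

lemma germ_eq_germ_comp {X Y : Stalk x} (v : CentralIdempotent C) (hv : v.toZI ∈ x)
    (f : X.obj ⊗ v.obj ⟶ Y.obj) :
    germ v hv f = germ (Y := (toStalk x).obj (X.obj ⊗ v.obj)) v hv (𝟙 _) ≫ (toStalk x).map f := by
  symm
  change germ (v.tensor unit) _ ((α_ X.obj v.obj (𝟙_ C)).inv ≫ (𝟙 (X.obj ⊗ v.obj)) ▷ (𝟙_ C) ≫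
    (ρ_ (X.obj ⊗ v.obj)).hom ≫ f) = germ v hv f
  refine germ_eq (tensor_mem hv (unit_mem x)) (.id _) (tensorFst _ _) ?_
  change X.obj ◁ (𝟙 _) ≫ _ = X.obj ◁ (v.obj ◁ 𝟙 (𝟙_ C) ≫ (ρ_ v.obj).hom) ≫ f
  simp

lemma isIso_toStalk_counit (A : C) (v : CentralIdempotent C) (hv : v.toZI ∈ x) :
    IsIso ((toStalk x).map (counit A v)) := by
  refine ⟨germ (X := ⟨A⟩) (Y := ⟨A ⊗ v.obj⟩) v hv (𝟙 _), ?_, ?_⟩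
  · refine (toStalk_counit_comp_germ (X := ⟨A⟩) (Y := ⟨A ⊗ v.obj⟩) v hv (𝟙 _)).trans ?_
    exact (toStalk x).map_id _
  · refine (germ_eq_germ_comp (X := ⟨A⟩) (Y := ⟨A⟩) v hv (counit A v)).symm.trans ?_
    refine germ_eq hv (.id _) v.toUnit ?_
    change A ◁ (𝟙 _) ≫ A ◁ v.hom ≫ (ρ_ A).hom = A ◁ v.hom ≫ (ρ_ A).hom
    simp

/-- Every morphism of the stalk is a fraction of morphisms of `C`. -/
lemma exists_fraction {X Y : Stalk x} (φ : X ⟶ Y) :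
    ∃ (A : C) (e : A ⟶ X.obj) (f : A ⟶ Y.obj), IsIso ((toStalk x).map e) ∧
      (toStalk x).map e ≫ φ = (toStalk x).map f := by
  induction φ using ind with | h v hv f =>
  exact ⟨_, counit X.obj v, f, isIso_toStalk_counit _ v hv, toStalk_counit_comp_germ v hv f⟩

/-- `Z ◁ [v, f] = [v, Z ⊗ f]`. -/
def whiskerLeft (Z : Stalk x) {X Y : Stalk x} :
    (X ⟶ Y) → ((⟨Z.obj ⊗ X.obj⟩ : Stalk x) ⟶ ⟨Z.obj ⊗ Y.obj⟩) :=
  Quotient.map (fun r => ⟨r.idem, r.mem, (α_ Z.obj X.obj r.idem.obj).hom ≫ Z.obj ◁ r.map⟩) (by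
    rintro r s ⟨w, hw, m, n, h⟩
    refine ⟨w, hw, m, n, ?_⟩
    change (Z.obj ⊗ X.obj) ◁ m.hom ≫ (α_ Z.obj X.obj r.idem.obj).hom ≫ Z.obj ◁ r.map =
      (Z.obj ⊗ X.obj) ◁ n.hom ≫ (α_ Z.obj X.obj s.idem.obj).hom ≫ Z.obj ◁ s.map
    simp only [tensor_whiskerLeft, Category.assoc, Iso.inv_hom_id_assoc, ← whiskerLeft_comp, h])

/-- `[v, f] ▷ Z = [v, f ⊗ Z]`, where the half-braiding moves `v` past `Z`. -/
def whiskerRight {X Y : Stalk x} (φ : X ⟶ Y) (Z : Stalk x) :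
    (⟨X.obj ⊗ Z.obj⟩ : Stalk x) ⟶ ⟨Y.obj ⊗ Z.obj⟩ :=
  Quotient.map (fun r => ⟨r.idem, r.mem, (α_ X.obj Z.obj r.idem.obj).hom ≫
      X.obj ◁ (r.idem.braid.β Z.obj).inv ≫ (α_ X.obj r.idem.obj Z.obj).inv ≫ r.map ▷ Z.obj⟩) (by
    rintro r s ⟨w, hw, m, n, h⟩
    refine ⟨w, hw, m, n, ?_⟩
    change (X.obj ⊗ Z.obj) ◁ m.hom ≫ (α_ X.obj Z.obj r.idem.obj).hom ≫
      X.obj ◁ (r.idem.braid.β Z.obj).inv ≫ (α_ X.obj r.idem.obj Z.obj).inv ≫ r.map ▷ Z.obj =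
      (X.obj ⊗ Z.obj) ◁ n.hom ≫ (α_ X.obj Z.obj s.idem.obj).hom ≫
      X.obj ◁ (s.idem.braid.β Z.obj).inv ≫ (α_ X.obj s.idem.obj Z.obj).inv ≫ s.map ▷ Z.obj
    have key : ∀ {a : CentralIdempotent C} (m : Hom w a) (f : X.obj ⊗ a.obj ⟶ Y.obj),
        (X.obj ⊗ Z.obj) ◁ m.hom ≫ (α_ X.obj Z.obj a.obj).hom ≫
          X.obj ◁ (a.braid.β Z.obj).inv ≫ (α_ X.obj a.obj Z.obj).inv ≫ f ▷ Z.obj =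
        (α_ X.obj Z.obj w.obj).hom ≫
          X.obj ◁ (w.braid.β Z.obj).inv ≫ (α_ X.obj w.obj Z.obj).inv ≫
            (X.obj ◁ m.hom ≫ f) ▷ Z.obj := by
      intro a m f
      have hm : Z.obj ◁ m.hom ≫ (a.braid.β Z.obj).inv = (w.braid.β Z.obj).inv ≫ m.hom ▷ Z.obj := by
        rw [Iso.comp_inv_eq, Category.assoc, Iso.eq_inv_comp, m.comm]
      calc _ = 𝟙 _ ⊗≫ X.obj ◁ (Z.obj ◁ m.hom ≫ (a.braid.β Z.obj).inv) ⊗≫ f ▷ Z.obj := by monoidal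
        _ = _ := by rw [hm]; monoidal
    rw [key, key, h]) φ

lemma whiskerLeft_germ (Z : Stalk x) {X Y : Stalk x} (v : CentralIdempotent C) (hv : v.toZI ∈ x)
    (f : X.obj ⊗ v.obj ⟶ Y.obj) : whiskerLeft Z (germ v hv f) =
      germ v hv ((α_ Z.obj X.obj v.obj).hom ≫ Z.obj ◁ f) := rfl

lemma whiskerRight_germ (Z : Stalk x) {X Y : Stalk x} (v : CentralIdempotent C) (hv : v.toZI ∈ x)
    (f : X.obj ⊗ v.obj ⟶ Y.obj) : whiskerRight (germ v hv f) Z =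
      germ v hv ((α_ X.obj Z.obj v.obj).hom ≫ X.obj ◁ (v.braid.β Z.obj).inv ≫
        (α_ X.obj v.obj Z.obj).inv ≫ f ▷ Z.obj) := rfl

lemma whiskerLeft_map (Z : Stalk x) {A B : C} (f : A ⟶ B) :
    whiskerLeft Z ((toStalk x).map f) = (toStalk x).map (Z.obj ◁ f) := by
  change germ unit _ ((α_ Z.obj A (𝟙_ C)).hom ≫ Z.obj ◁ ((ρ_ A).hom ≫ f)) =
    germ unit _ ((ρ_ (Z.obj ⊗ A)).hom ≫ Z.obj ◁ f)
  congr 1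
  monoidal

lemma whiskerRight_map (Z : Stalk x) {A B : C} (f : A ⟶ B) :
    whiskerRight ((toStalk x).map f) Z = (toStalk x).map (f ▷ Z.obj) := by
  change germ unit _ ((α_ A Z.obj (𝟙_ C)).hom ≫ A ◁ ((ρ_ Z.obj).hom ≫ (λ_ Z.obj).inv) ≫
    (α_ A (𝟙_ C) Z.obj).inv ≫ ((ρ_ A).hom ≫ f) ▷ Z.obj) =
    germ unit _ ((ρ_ (A ⊗ Z.obj)).hom ≫ f ▷ Z.obj)
  congr 1
  monoidal

lemma whiskerLeft_comp (Z : Stalk x) {X Y W : Stalk x} (φ : X ⟶ Y) (ψ : Y ⟶ W) :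
    whiskerLeft Z (φ ≫ ψ) = whiskerLeft Z φ ≫ whiskerLeft Z ψ := by
  induction φ using ind with | h u hu f =>
  induction ψ using ind with | h v hv g =>
  simp only [germ_comp_germ, whiskerLeft_germ]
  congr 1
  monoidal

lemma whiskerRight_comp (Z : Stalk x) {X Y W : Stalk x} (φ : X ⟶ Y) (ψ : Y ⟶ W) :
    whiskerRight (φ ≫ ψ) Z = whiskerRight φ Z ≫ whiskerRight ψ Z := by
  induction φ using ind with | h u hu f =>
  induction ψ using ind with | h v hv g =>
  change germ (u.tensor v) _ ((α_ X.obj Z.obj (u.obj ⊗ v.obj)).hom ≫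
    X.obj ◁ ((α_ u.obj v.obj Z.obj) ≪≫ whiskerLeftIso u.obj (v.braid.β Z.obj) ≪≫
      (α_ u.obj Z.obj v.obj).symm ≪≫ whiskerRightIso (u.braid.β Z.obj) v.obj ≪≫
        α_ Z.obj u.obj v.obj).inv ≫ (α_ X.obj (u.obj ⊗ v.obj) Z.obj).inv ≫
    ((α_ X.obj u.obj v.obj).inv ≫ f ▷ v.obj ≫ g) ▷ Z.obj) =
    germ (u.tensor v) _ ((α_ (X.obj ⊗ Z.obj) u.obj v.obj).inv ≫
      ((α_ X.obj Z.obj u.obj).hom ≫ X.obj ◁ (u.braid.β Z.obj).inv ≫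
        (α_ X.obj u.obj Z.obj).inv ≫ f ▷ Z.obj) ▷ v.obj ≫
      (α_ Y.obj Z.obj v.obj).hom ≫ Y.obj ◁ (v.braid.β Z.obj).inv ≫
        (α_ Y.obj v.obj Z.obj).inv ≫ g ▷ Z.obj)
  congr 1
  simp only [Iso.trans_inv, whiskerLeftIso_inv, whiskerRightIso_inv, Iso.symm_inv]
  calc _ = 𝟙 _ ⊗≫ X.obj ◁ (u.braid.β Z.obj).inv ▷ v.obj ⊗≫
        ((X.obj ⊗ u.obj) ◁ (v.braid.β Z.obj).inv ≫ f ▷ (v.obj ⊗ Z.obj)) ⊗≫ g ▷ Z.obj := by monoidal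
    _ = _ := by rw [whisker_exchange]; monoidal

lemma whiskerLeft_id (Z X : Stalk x) : whiskerLeft Z (𝟙 X) = 𝟙 (⟨Z.obj ⊗ X.obj⟩ : Stalk x) := by
  have h := whiskerLeft_map Z (𝟙 X.obj)
  rwa [MonoidalCategory.whiskerLeft_id, (toStalk x).map_id, (toStalk x).map_id] at h

lemma id_whiskerRight (X Z : Stalk x) : whiskerRight (𝟙 X) Z = 𝟙 (⟨X.obj ⊗ Z.obj⟩ : Stalk x) := by
  have h := whiskerRight_map Z (𝟙 X.obj)
  rwa [MonoidalCategory.id_whiskerRight, (toStalk x).map_id, (toStalk x).map_id] at h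

lemma isIso_whiskerLeft (Z : Stalk x) {X Y : Stalk x} (φ : X ⟶ Y) [IsIso φ] :
    IsIso (whiskerLeft Z φ) :=
  ⟨whiskerLeft Z (inv φ), by rw [← whiskerLeft_comp, IsIso.hom_inv_id, whiskerLeft_id],
    by rw [← whiskerLeft_comp, IsIso.inv_hom_id, whiskerLeft_id]⟩

lemma isIso_whiskerRight (Z : Stalk x) {X Y : Stalk x} (φ : X ⟶ Y) [IsIso φ] :
    IsIso (whiskerRight φ Z) :=
  ⟨whiskerRight (inv φ) Z, by rw [← whiskerRight_comp, IsIso.hom_inv_id, id_whiskerRight],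
    by rw [← whiskerRight_comp, IsIso.inv_hom_id, id_whiskerRight]⟩

lemma whisker_exchange' {X Y Z W : Stalk x} (φ : X ⟶ Y) (ψ : Z ⟶ W) :
    whiskerRight φ Z ≫ whiskerLeft Y ψ = whiskerLeft X ψ ≫ whiskerRight φ W := by
  obtain ⟨X⟩ := X
  obtain ⟨Y⟩ := Y
  obtain ⟨Z⟩ := Z
  obtain ⟨W⟩ := W
  obtain ⟨A, e, f, he, hf⟩ := exists_fraction φ
  obtain ⟨B, d, g, hd, hg⟩ := exists_fraction ψ
  have i1 := isIso_whiskerLeft ⟨A⟩ ((toStalk x).map d)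
  have i2 := isIso_whiskerRight ⟨Z⟩ ((toStalk x).map e)
  have ex : ∀ {a b c d : C} (p : a ⟶ b) (q : c ⟶ d),
      whiskerLeft ⟨a⟩ ((toStalk x).map q) ≫ whiskerRight ((toStalk x).map p) ⟨d⟩ =
        whiskerRight ((toStalk x).map p) ⟨c⟩ ≫ whiskerLeft ⟨b⟩ ((toStalk x).map q) := by
    intro a b c d p q
    rw [whiskerLeft_map, whiskerLeft_map, whiskerRight_map, whiskerRight_map]
    exact ((toStalk x).map_comp _ _).symm.trans
      ((congrArg _ (whisker_exchange p q)).trans ((toStalk x).map_comp _ _))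
  rw [← cancel_epi (whiskerRight ((toStalk x).map e) ⟨Z⟩),
    ← cancel_epi (whiskerLeft ⟨A⟩ ((toStalk x).map d))]
  calc _ = whiskerLeft ⟨A⟩ ((toStalk x).map d) ≫ whiskerRight ((toStalk x).map f) ⟨Z⟩ ≫
        whiskerLeft ⟨Y⟩ ψ := by
        rw [← hf, whiskerRight_comp, Category.assoc]
    _ = whiskerRight ((toStalk x).map f) ⟨B⟩ ≫ whiskerLeft ⟨Y⟩ ((toStalk x).map g) := by
        rw [← Category.assoc, ex, Category.assoc, ← whiskerLeft_comp, hg]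
    _ = whiskerLeft ⟨A⟩ ((toStalk x).map g) ≫ whiskerRight ((toStalk x).map e) ⟨W⟩ ≫
        whiskerRight φ ⟨W⟩ := by
        rw [← ex, ← hf, whiskerRight_comp]
    _ = _ := by
        rw [← Category.assoc, ex, Category.assoc, ← hg, whiskerLeft_comp, Category.assoc,
          ← Category.assoc (whiskerRight _ _), ← ex, Category.assoc]

/-- The tensor product of objects is that of `C`, and
`[u, f] ⊗ [v, g] = [u ∧ v, (f ⊗ g) ∘ (A ⊗ σ⁻¹ ⊗ v)]`, with `σ` the half-braiding of `u`. -/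
instance : MonoidalCategoryStruct (Stalk x) where
  tensorObj X Y := ⟨X.obj ⊗ Y.obj⟩
  whiskerLeft Z _ _ φ := whiskerLeft Z φ
  whiskerRight φ Z := whiskerRight φ Z
  tensorHom {_ Y Z _} φ ψ := whiskerRight φ Z ≫ whiskerLeft Y ψ
  tensorUnit := ⟨𝟙_ C⟩
  associator X Y Z := (toStalk x).mapIso (α_ X.obj Y.obj Z.obj)
  leftUnitor X := (toStalk x).mapIso (λ_ X.obj)
  rightUnitor X := (toStalk x).mapIso (ρ_ X.obj)

lemma whiskerLeft_map' (Z : C) {A B : C} (f : A ⟶ B) :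
    (toStalk x).obj Z ◁ (toStalk x).map f = (toStalk x).map (Z ◁ f) := whiskerLeft_map _ _

lemma whiskerRight_map' (Z : C) {A B : C} (f : A ⟶ B) :
    (toStalk x).map f ▷ (toStalk x).obj Z = (toStalk x).map (f ▷ Z) := whiskerRight_map _ _

lemma map_comp_map {A B D : C} (f : A ⟶ B) (g : B ⟶ D) :
    (toStalk x).map f ≫ (toStalk x).map g = (toStalk x).map (f ≫ g) :=
  ((toStalk x).map_comp f g).symm

lemma associator_naturality_left {X Y : Stalk x} (φ : X ⟶ Y) (Z W : Stalk x) :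
    whiskerRight (whiskerRight φ Z) W ≫ (toStalk x).map (α_ Y.obj Z.obj W.obj).hom =
      (toStalk x).map (α_ X.obj Z.obj W.obj).hom ≫ whiskerRight φ ⟨Z.obj ⊗ W.obj⟩ := by
  obtain ⟨X⟩ := X
  obtain ⟨Y⟩ := Y
  obtain ⟨Z⟩ := Z
  obtain ⟨W⟩ := W
  obtain ⟨A, e, f, he, hf⟩ := exists_fraction φ
  have i1 := isIso_whiskerRight ⟨Z⟩ ((toStalk x).map e)
  have i2 := isIso_whiskerRight ⟨W⟩ (whiskerRight ((toStalk x).map e) ⟨Z⟩)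
  rw [← cancel_epi (whiskerRight (whiskerRight ((toStalk x).map e) ⟨Z⟩) ⟨W⟩)]
  calc _ = whiskerRight (whiskerRight ((toStalk x).map f) ⟨Z⟩) ⟨W⟩ ≫
        (toStalk x).map (α_ Y Z W).hom := by
        rw [← Category.assoc, ← whiskerRight_comp, ← whiskerRight_comp, hf]
    _ = (toStalk x).map (α_ A Z W).hom ≫ whiskerRight ((toStalk x).map f) ⟨Z ⊗ W⟩ := by
        rw [whiskerRight_map, whiskerRight_map, whiskerRight_map, map_comp_map, map_comp_map,
          MonoidalCategory.associator_naturality_left]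
    _ = ((toStalk x).map (α_ A Z W).hom ≫ whiskerRight ((toStalk x).map e) ⟨Z ⊗ W⟩) ≫
          whiskerRight φ ⟨Z ⊗ W⟩ := by
        rw [← hf, whiskerRight_comp, Category.assoc]
    _ = _ := by
        rw [whiskerRight_map, whiskerRight_map, whiskerRight_map, map_comp_map,
          ← MonoidalCategory.associator_naturality_left, ← map_comp_map, Category.assoc]

lemma associator_naturality_middle (Z : Stalk x) {X Y : Stalk x} (φ : X ⟶ Y) (W : Stalk x) :
    whiskerRight (whiskerLeft Z φ) W ≫ (toStalk x).map (α_ Z.obj Y.obj W.obj).hom =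
      (toStalk x).map (α_ Z.obj X.obj W.obj).hom ≫ whiskerLeft Z (whiskerRight φ W) := by
  obtain ⟨X⟩ := X
  obtain ⟨Y⟩ := Y
  obtain ⟨Z⟩ := Z
  obtain ⟨W⟩ := W
  obtain ⟨A, e, f, he, hf⟩ := exists_fraction φ
  have i1 := isIso_whiskerLeft ⟨Z⟩ ((toStalk x).map e)
  have i2 := isIso_whiskerRight ⟨W⟩ (whiskerLeft ⟨Z⟩ ((toStalk x).map e))
  rw [← cancel_epi (whiskerRight (whiskerLeft ⟨Z⟩ ((toStalk x).map e)) ⟨W⟩)]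
  calc _ = whiskerRight (whiskerLeft ⟨Z⟩ ((toStalk x).map f)) ⟨W⟩ ≫
        (toStalk x).map (α_ Z Y W).hom := by
        rw [← Category.assoc, ← whiskerRight_comp, ← whiskerLeft_comp, hf]
    _ = (toStalk x).map (α_ Z A W).hom ≫ whiskerLeft ⟨Z⟩ (whiskerRight ((toStalk x).map f) ⟨W⟩) := by
        rw [whiskerRight_map, whiskerLeft_map, whiskerLeft_map, whiskerRight_map, map_comp_map,
          map_comp_map, MonoidalCategory.associator_naturality_middle]
    _ = ((toStalk x).map (α_ Z A W).hom ≫ whiskerLeft ⟨Z⟩ (whiskerRight ((toStalk x).map e) ⟨W⟩)) ≫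
          whiskerLeft ⟨Z⟩ (whiskerRight φ ⟨W⟩) := by
        rw [← hf, whiskerRight_comp, whiskerLeft_comp, Category.assoc]
    _ = _ := by
        rw [whiskerRight_map, whiskerLeft_map, whiskerLeft_map, whiskerRight_map, map_comp_map,
          ← MonoidalCategory.associator_naturality_middle, ← map_comp_map, Category.assoc]

lemma associator_naturality_right (Z W : Stalk x) {X Y : Stalk x} (φ : X ⟶ Y) :
    whiskerLeft ⟨Z.obj ⊗ W.obj⟩ φ ≫ (toStalk x).map (α_ Z.obj W.obj Y.obj).hom =
      (toStalk x).map (α_ Z.obj W.obj X.obj).hom ≫ whiskerLeft Z (whiskerLeft W φ) := by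
  obtain ⟨X⟩ := X
  obtain ⟨Y⟩ := Y
  obtain ⟨Z⟩ := Z
  obtain ⟨W⟩ := W
  obtain ⟨A, e, f, he, hf⟩ := exists_fraction φ
  have i1 := isIso_whiskerLeft ⟨Z ⊗ W⟩ ((toStalk x).map e)
  rw [← cancel_epi (whiskerLeft ⟨Z ⊗ W⟩ ((toStalk x).map e))]
  calc _ = whiskerLeft ⟨Z ⊗ W⟩ ((toStalk x).map f) ≫ (toStalk x).map (α_ Z W Y).hom := by
        rw [← Category.assoc, ← whiskerLeft_comp, hf]
    _ = (toStalk x).map (α_ Z W A).hom ≫ whiskerLeft ⟨Z⟩ (whiskerLeft ⟨W⟩ ((toStalk x).map f)) := by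
        rw [whiskerLeft_map, whiskerLeft_map, whiskerLeft_map, map_comp_map,
          map_comp_map, MonoidalCategory.associator_naturality_right]
    _ = ((toStalk x).map (α_ Z W A).hom ≫ whiskerLeft ⟨Z⟩ (whiskerLeft ⟨W⟩ ((toStalk x).map e))) ≫
          whiskerLeft ⟨Z⟩ (whiskerLeft ⟨W⟩ φ) := by
        rw [← hf, whiskerLeft_comp, whiskerLeft_comp, Category.assoc]
    _ = _ := by
        rw [whiskerLeft_map, whiskerLeft_map, whiskerLeft_map, map_comp_map,
          ← MonoidalCategory.associator_naturality_right, ← map_comp_map, Category.assoc]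

lemma leftUnitor_naturality {X Y : Stalk x} (φ : X ⟶ Y) :
    whiskerLeft ⟨𝟙_ C⟩ φ ≫ (toStalk x).map (λ_ Y.obj).hom = (toStalk x).map (λ_ X.obj).hom ≫ φ := by
  obtain ⟨X⟩ := X
  obtain ⟨Y⟩ := Y
  obtain ⟨A, e, f, he, hf⟩ := exists_fraction φ
  have i1 := isIso_whiskerLeft ⟨𝟙_ C⟩ ((toStalk x).map e)
  rw [← cancel_epi (whiskerLeft ⟨𝟙_ C⟩ ((toStalk x).map e))]
  calc _ = whiskerLeft ⟨𝟙_ C⟩ ((toStalk x).map f) ≫ (toStalk x).map (λ_ Y).hom := by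
        rw [← Category.assoc, ← whiskerLeft_comp, hf]
    _ = (toStalk x).map (λ_ A).hom ≫ (toStalk x).map f := by
        rw [whiskerLeft_map, map_comp_map, map_comp_map, MonoidalCategory.leftUnitor_naturality]
    _ = ((toStalk x).map (λ_ A).hom ≫ (toStalk x).map e) ≫ φ := by
        rw [← hf, Category.assoc]
    _ = _ := by
        rw [whiskerLeft_map, map_comp_map, ← MonoidalCategory.leftUnitor_naturality,
          ← map_comp_map, Category.assoc]

lemma rightUnitor_naturality {X Y : Stalk x} (φ : X ⟶ Y) :
    whiskerRight φ ⟨𝟙_ C⟩ ≫ (toStalk x).map (ρ_ Y.obj).hom =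
      (toStalk x).map (ρ_ X.obj).hom ≫ φ := by
  obtain ⟨X⟩ := X
  obtain ⟨Y⟩ := Y
  obtain ⟨A, e, f, he, hf⟩ := exists_fraction φ
  have i1 := isIso_whiskerRight ⟨𝟙_ C⟩ ((toStalk x).map e)
  rw [← cancel_epi (whiskerRight ((toStalk x).map e) ⟨𝟙_ C⟩)]
  calc _ = whiskerRight ((toStalk x).map f) ⟨𝟙_ C⟩ ≫ (toStalk x).map (ρ_ Y).hom := by
        rw [← Category.assoc, ← whiskerRight_comp, hf]
    _ = (toStalk x).map (ρ_ A).hom ≫ (toStalk x).map f := by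
        rw [whiskerRight_map, map_comp_map, map_comp_map, MonoidalCategory.rightUnitor_naturality]
    _ = ((toStalk x).map (ρ_ A).hom ≫ (toStalk x).map e) ≫ φ := by
        rw [← hf, Category.assoc]
    _ = _ := by
        rw [whiskerRight_map, map_comp_map, ← MonoidalCategory.rightUnitor_naturality,
          ← map_comp_map, Category.assoc]

instance : MonoidalCategory (Stalk x) where
  tensorHom_def _ _ := rfl
  id_tensorHom_id X Y := by
    change whiskerRight (𝟙 X) Y ≫ whiskerLeft X (𝟙 Y) = 𝟙 (⟨X.obj ⊗ Y.obj⟩ : Stalk x)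
    rw [whiskerLeft_id, id_whiskerRight, Category.comp_id]
  tensorHom_comp_tensorHom {X₁ Y₁ Z₁ X₂ Y₂ Z₂} f₁ f₂ g₁ g₂ := by
    change (whiskerRight f₁ X₂ ≫ whiskerLeft Y₁ f₂) ≫ whiskerRight g₁ Y₂ ≫ whiskerLeft Z₁ g₂ =
      whiskerRight (f₁ ≫ g₁) X₂ ≫ whiskerLeft Z₁ (f₂ ≫ g₂)
    rw [whiskerRight_comp, whiskerLeft_comp, Category.assoc, Category.assoc,
      ← Category.assoc (whiskerLeft _ _), ← whisker_exchange', Category.assoc]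
  whiskerLeft_id := whiskerLeft_id
  id_whiskerRight := id_whiskerRight
  associator_naturality {X₁ X₂ X₃ Y₁ Y₂ Y₃} f₁ f₂ f₃ := by
    change (whiskerRight (whiskerRight f₁ X₂ ≫ whiskerLeft Y₁ f₂) X₃ ≫
      whiskerLeft ⟨Y₁.obj ⊗ Y₂.obj⟩ f₃) ≫ (toStalk x).map (α_ Y₁.obj Y₂.obj Y₃.obj).hom =
      (toStalk x).map (α_ X₁.obj X₂.obj X₃.obj).hom ≫
        whiskerRight f₁ ⟨X₂.obj ⊗ X₃.obj⟩ ≫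
          whiskerLeft Y₁ (whiskerRight f₂ X₃ ≫ whiskerLeft Y₂ f₃)
    rw [whiskerRight_comp, whiskerLeft_comp, Category.assoc, Category.assoc,
      associator_naturality_right, ← Category.assoc (whiskerRight (whiskerLeft _ _) _),
      associator_naturality_middle, ← Category.assoc ((toStalk x).map _),
      ← associator_naturality_left]
    simp only [Category.assoc]
  leftUnitor_naturality φ := leftUnitor_naturality φ
  rightUnitor_naturality φ := rightUnitor_naturality φ
  pentagon W X Y Z := by
    change whiskerRight ((toStalk x).map (α_ W.obj X.obj Y.obj).hom) Z ≫
      (toStalk x).map (α_ W.obj (X.obj ⊗ Y.obj) Z.obj).hom ≫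
      whiskerLeft W ((toStalk x).map (α_ X.obj Y.obj Z.obj).hom) =
      (toStalk x).map (α_ (W.obj ⊗ X.obj) Y.obj Z.obj).hom ≫
      (toStalk x).map (α_ W.obj X.obj (Y.obj ⊗ Z.obj)).hom
    rw [whiskerRight_map, whiskerLeft_map, map_comp_map, map_comp_map, map_comp_map,
      MonoidalCategory.pentagon]
  triangle X Y := by
    change (toStalk x).map (α_ X.obj (𝟙_ C) Y.obj).hom ≫
      whiskerLeft X ((toStalk x).map (λ_ Y.obj).hom) =
      whiskerRight ((toStalk x).map (ρ_ X.obj).hom) Y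
    rw [whiskerRight_map, whiskerLeft_map, map_comp_map, MonoidalCategory.triangle]

/-- The quotient functor is strict monoidal. -/
instance : (toStalk x).Monoidal :=
  Functor.CoreMonoidal.toMonoidal
    { εIso := Iso.refl _
      μIso := fun _ _ => Iso.refl _
      μIso_hom_natural_left := fun f Z => by
        change whiskerRight ((toStalk x).map f) ⟨Z⟩ ≫ 𝟙 _ = 𝟙 _ ≫ (toStalk x).map (f ▷ Z)
        rw [whiskerRight_map, Category.comp_id, Category.id_comp]
      μIso_hom_natural_right := fun Z f => by
        change whiskerLeft ⟨Z⟩ ((toStalk x).map f) ≫ 𝟙 _ = 𝟙 _ ≫ (toStalk x).map (Z ◁ f)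
        rw [whiskerLeft_map, Category.comp_id, Category.id_comp]
      associativity := fun X Y Z => by
        change whiskerRight (𝟙 _) ⟨Z⟩ ≫ 𝟙 _ ≫ (toStalk x).map (α_ X Y Z).hom =
          (toStalk x).map (α_ X Y Z).hom ≫ whiskerLeft ⟨X⟩ (𝟙 _) ≫ 𝟙 _
        rw [whiskerLeft_id, id_whiskerRight]
        simp only [Category.comp_id, Category.id_comp]
      left_unitality := fun X => by
        change (toStalk x).map (λ_ X).hom =
          whiskerRight (𝟙 _) ⟨X⟩ ≫ 𝟙 _ ≫ (toStalk x).map (λ_ X).hom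
        rw [id_whiskerRight]
        simp only [Category.id_comp]
      right_unitality := fun X => by
        change (toStalk x).map (ρ_ X).hom =
          whiskerLeft ⟨X⟩ (𝟙 _) ≫ 𝟙 _ ≫ (toStalk x).map (ρ_ X).hom
        rw [whiskerLeft_id]
        simp only [Category.id_comp] }

end Stalk

end Stalk

section UniversalJoins

open CategoryTheory.Limits

/-- `C` has universal finite joins of central idempotents: it has an initial object `0` that is
absorbing for the tensor product, and any two central idempotents `u`, `v` have a join `w` in
`ZI(C)` such that for every object `A` the square
```
A ⊗ U ⊗ V ⟶ A ⊗ V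
    |         |
    v         v
  A ⊗ U   ⟶ A ⊗ W
```
is both a pullback and a pushout. -/
structure HasUniversalFiniteJoins (C : Type u) [Category.{v} C] [MonoidalCategory C] : Prop where
  exists_zero : ∃ Z : C, Nonempty (IsInitial Z) ∧
    ∀ A : C, Nonempty (A ⊗ Z ≅ Z) ∧ Nonempty (Z ⊗ A ≅ Z)
  exists_join : ∀ u v : CentralIdempotent C, ∃ (w : CentralIdempotent C)
    (i : CentralIdempotent.Hom u w) (j : CentralIdempotent.Hom v w),
    IsLUB {u.toZI, v.toZI} w.toZI ∧
    ∀ A : C, BicartesianSq (A ◁ (u.tensorFst v).hom) (A ◁ (u.tensorSnd v).hom)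
      (A ◁ i.hom) (A ◁ j.hom)

/-- A prime filter: a nonempty, upward-closed, downward-directed, proper subset that contains one
of `a`, `b` whenever it contains their join. -/
structure PrimeFilter (P : Type u) [PartialOrder P] where
  filter : Order.PFilter P
  proper : ∃ a : P, a ∉ filter
  prime : ∀ a b c : P, IsLUB {a, b} c → c ∈ filter → a ∈ filter ∨ b ∈ filter

/-- A partially ordered set with top `1` is `∨`-local when it has at least two elements and
`a ∨ b = 1` only if `a = 1` or `b = 1`. -/
def IsVeeLocalOrder (P : Type u) [PartialOrder P] [OrderTop P] : Prop :=
  Nontrivial P ∧ ∀ a b : P, IsLUB {a, b} ⊤ → a = ⊤ ∨ b = ⊤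

/-- A monoidal category is `∨`-local when its poset of central idempotents is. -/
def IsVeeLocal (C : Type u) [Category.{v} C] [MonoidalCategory C] : Prop :=
  IsVeeLocalOrder (ZI C)

/-- The functor from `C` to the product of its stalks at the prime filters of central idempotents,
whose components are the quotient functors; it is the identity on objects in each component. -/
def toStalks (C : Type u) [Category.{v} C] [MonoidalCategory C] :
    C ⥤ (∀ x : PrimeFilter (ZI C), Stalk x.filter) :=
  Functor.pi' fun x => Stalk.toStalk x.filter

end UniversalJoins

/-! Join squares stay pushouts after tensoring, so meets distribute over joins (`tensor_le`) and `ZI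
C` is a distributive lattice; its bottom is carried by the initial object. For parallel `f g : A ⟶
B`, the idempotents on which they agree form an ideal: the join square for `A` is a pushout, and `A
⊗ 0` is initial. If `f ≠ g`, this ideal misses `⊤`, so the prime ideal theorem provides a prime
filter that avoids it, and `f`, `g` remain different in the stalk there. This is faithfulness.

If `C` is braided, every central idempotent of a stalk comes from `C` (`exists_mapIdem_toZI_eq`).
Write it as a fraction `e⁻¹ ≫ f` with `f : A ⟶ 𝟙_ C`. The equations and the inverse that make `f`
idempotent in the stalk already live on some `z` in the filter, so `f` restricted to `A ⊗ z` is a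
central idempotent of `C`, with half-braiding given by the braiding. An idempotent of `C` becomes
`⊤` in the stalk exactly when it lies in the filter (`mapIdem_eq_top_iff`), so primality of the
filter yields `∨`-locality of the stalk.

Without a braiding, `A ⊗ z` has no evident half-braiding, and the embedding takes another route.
Adjoin a strict initial object to `C` and let `C` act by tensoring on the right, inside the category
of endofunctors that fix the new object. A central idempotent there commutes with the constant
functors, which forces it to be `0` or `1` (`isIso_hom_or_isInitial`). That category is therefore
`∨`-local, and a single factor suffices. -/

section Order

variable {C : Type u} [Category.{v} C] [MonoidalCategory C]

/-! ### The distributive lattice of central idempotents and its prime filters. -/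

namespace CentralIdempotent

open CategoryTheory.Limits

lemma exists_toZI_eq (a : ZI C) : ∃ u : CentralIdempotent C, u.toZI = a := Quotient.exists_rep a

lemma Hom.toZI_le {u v : CentralIdempotent C} (m : Hom u v) : u.toZI ≤ v.toZI := ⟨m⟩

lemma isGLB_tensor (u v : CentralIdempotent C) :
    IsGLB {u.toZI, v.toZI} (u.tensor v).toZI := by
  refine ⟨?_, fun a ha => ?_⟩
  · rintro _ (rfl | rfl)
    exacts [(u.tensorFst v).toZI_le, (u.tensorSnd v).toZI_le]
  · obtain ⟨w, rfl⟩ := exists_toZI_eq a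
    obtain ⟨m⟩ := ha (Or.inl rfl)
    obtain ⟨n⟩ := ha (Or.inr rfl)
    exact (m.lift n).toZI_le

/-- An initial object that is absorbing for the tensor product is a central idempotent. -/
lemma exists_obj_isInitial (h : ∃ Z : C, Nonempty (IsInitial Z) ∧
    ∀ A : C, Nonempty (A ⊗ Z ≅ Z) ∧ Nonempty (Z ⊗ A ≅ Z)) :
    ∃ z : CentralIdempotent C, Nonempty (IsInitial z.obj) := by
  obtain ⟨Z, ⟨hZ⟩, h⟩ := h
  -- Tensor products with `Z` are initial on either side, so all the axioms below compare morphisms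
  -- out of an initial object.
  have hr (A : C) : IsInitial (Z ⊗ A) := hZ.ofIso (h A).2.some.symm
  have hl (A : C) : IsInitial (A ⊗ Z) := hZ.ofIso (h A).1.some.symm
  have : IsIso (hZ.to (𝟙_ C) ▷ Z ≫ (λ_ Z).hom) :=
    ⟨hZ.to _, (hr Z).hom_ext _ _, hZ.hom_ext _ _⟩
  exact ⟨{ obj := Z
           hom := hZ.to _
           braid :=
            { β := fun A => (hr A).uniqueUpToIso (hl A)
              monoidal := fun A B => (hr _).hom_ext _ _
              naturality := fun f => (hr _).hom_ext _ _ }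
           hom_braid := fun A => (hr A).hom_ext _ _
           central := (hr Z).hom_ext _ _
           isIso_left := this }, ⟨hZ⟩⟩

lemma toZI_le_of_isInitial {z : CentralIdempotent C} (hz : IsInitial z.obj) (a : ZI C) :
    z.toZI ≤ a := by
  obtain ⟨u, rfl⟩ := exists_toZI_eq a
  exact (Hom.ofFac (hz.to u.obj) (hz.hom_ext _ _)).toZI_le

end CentralIdempotent

open CentralIdempotent

lemma Stalk.counit_res (A : C) {a b : CentralIdempotent C} (m : Hom a b) :
    A ◁ m.hom ≫ Stalk.counit A b = Stalk.counit A a := by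
  rw [Stalk.counit, Stalk.counit, ← MonoidalCategory.whiskerLeft_comp_assoc, m.fac]

namespace HasUniversalFiniteJoins

lemma exists_isLUB (hC : HasUniversalFiniteJoins C) (a b : ZI C) : ∃ c, IsLUB {a, b} c := by
  obtain ⟨u, rfl⟩ := exists_toZI_eq a
  obtain ⟨v, rfl⟩ := exists_toZI_eq b
  obtain ⟨w, -, -, hw, -⟩ := hC.exists_join u v
  exact ⟨_, hw⟩

/-- Tensoring preserves the pushout square that exhibits a join, so meets distribute over
joins. -/
lemma tensor_le (hC : HasUniversalFiniteJoins C) {u v w d s : CentralIdempotent C}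
    (hd : IsLUB {v.toZI, w.toZI} d.toZI) (h₁ : (u.tensor v).toZI ≤ s.toZI)
    (h₂ : (u.tensor w).toZI ≤ s.toZI) : (u.tensor d).toZI ≤ s.toZI := by
  obtain ⟨t, i, j, ht, hsq⟩ := hC.exists_join v w
  -- The pushout squares are known only for the representative `t` of the join; `k` carries the
  -- conclusion back to `d`.
  obtain ⟨k⟩ : d.toZI ≤ t.toZI := hd.2 ht.1
  obtain ⟨m⟩ := h₁
  obtain ⟨n⟩ := h₂
  have hp := (hsq u.obj).toIsPushout
  have hm : m.hom ≫ s.hom = (u.hom ⊗ₘ v.hom) ≫ (λ_ (𝟙_ C)).hom := m.fac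
  have hn : n.hom ≫ s.hom = (u.hom ⊗ₘ w.hom) ≫ (λ_ (𝟙_ C)).hom := n.fac
  -- Both composites lie over the unit, so they agree by `fac_unique`; this is the cocone condition
  -- that induces a map `u ⊗ t ⟶ s`.
  have e : u.obj ◁ (v.tensorFst w).hom ≫ m.hom = u.obj ◁ (v.tensorSnd w).hom ≫ n.hom := by
    have h₁ := ((Hom.tensor (.id u) (v.tensorFst w)).comp m).fac
    have h₂ := ((Hom.tensor (.id u) (v.tensorSnd w)).comp n).fac
    change ((𝟙 u.obj ⊗ₘ (v.tensorFst w).hom) ≫ m.hom) ≫ s.hom = _ at h₁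
    change ((𝟙 u.obj ⊗ₘ (v.tensorSnd w).hom) ≫ n.hom) ≫ s.hom = _ at h₂
    rw [id_tensorHom] at h₁ h₂
    exact fac_unique (u := u.tensor (v.tensor w)) _ _ h₁ h₂
  -- The induced map lies over the unit because it does so on both legs of the pushout;
  -- compatibility with the half-braidings is then automatic by `Hom.ofFac`.
  refine le_trans (Hom.tensor (.id u) k).toZI_le
    (Hom.ofFac (u := u.tensor t) (hp.desc m.hom n.hom e) (hp.hom_ext ?_ ?_)).toZI_le
  · change _ = u.obj ◁ i.hom ≫ (u.hom ⊗ₘ t.hom) ≫ (λ_ (𝟙_ C)).hom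
    rw [hp.inl_desc_assoc, hm, ← id_tensorHom, tensorHom_comp_tensorHom_assoc, i.fac,
      Category.id_comp]
  · change _ = u.obj ◁ j.hom ≫ (u.hom ⊗ₘ t.hom) ≫ (λ_ (𝟙_ C)).hom
    rw [hp.inr_desc_assoc, hn, ← id_tensorHom, tensorHom_comp_tensorHom_assoc, j.fac,
      Category.id_comp]

/-- The central idempotents form a distributive lattice. -/
noncomputable abbrev distribLattice (hC : HasUniversalFiniteJoins C) : DistribLattice (ZI C) :=
  letI : Lattice (ZI C) :=
    { (inferInstance : PartialOrder (ZI C)) with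
      sup a b := (hC.exists_isLUB a b).choose
      le_sup_left a b := (hC.exists_isLUB a b).choose_spec.1 (Or.inl rfl)
      le_sup_right a b := (hC.exists_isLUB a b).choose_spec.1 (Or.inr rfl)
      sup_le a b c h k := (hC.exists_isLUB a b).choose_spec.2 (by rintro _ (rfl | rfl) <;> assumption)
      inf a b := (a.out.tensor b.out).toZI
      inf_le_left a b := by
        refine (isGLB_tensor _ _).1 (Or.inl ?_)
        exact (Quotient.out_eq a).symm
      inf_le_right a b := by
        refine (isGLB_tensor _ _).1 (Or.inr ?_)
        exact (Quotient.out_eq b).symm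
      le_inf a b c h k := by
        refine (isGLB_tensor _ _).2 ?_
        rintro _ (rfl | rfl)
        exacts [h.trans_eq (Quotient.out_eq b).symm, k.trans_eq (Quotient.out_eq c).symm] }
  .ofInfSupLe fun a b c => by
    obtain ⟨s, hs⟩ := exists_toZI_eq (a ⊓ b ⊔ a ⊓ c)
    rw [← hs]
    refine hC.tensor_le (v := b.out) (w := c.out) ?_ ?_ ?_
    · have e (a : ZI C) : a.out.toZI = a := Quotient.out_eq a
      rw [e, e, e]
      exact (hC.exists_isLUB b c).choose_spec
    · exact hs ▸ le_sup_left (a := a ⊓ b)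
    · exact hs ▸ le_sup_right (b := a ⊓ c)

/-- The central idempotents on which two parallel morphisms agree are closed under joins. -/
lemma counit_comp_eq_of_isLUB (hC : HasUniversalFiniteJoins C) {A B : C} {f g : A ⟶ B}
    {u v w : CentralIdempotent C} (hw : IsLUB {u.toZI, v.toZI} w.toZI)
    (hu : Stalk.counit A u ≫ f = Stalk.counit A u ≫ g)
    (hv : Stalk.counit A v ≫ f = Stalk.counit A v ≫ g) :
    Stalk.counit A w ≫ f = Stalk.counit A w ≫ g := by
  obtain ⟨t, i, j, ht, hsq⟩ := hC.exists_join u v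
  obtain ⟨k⟩ : w.toZI ≤ t.toZI := hw.2 ht.1
  have h : Stalk.counit A t ≫ f = Stalk.counit A t ≫ g := by
    -- The legs of a pushout are jointly epic, and restricting along them gives the restrictions to
    -- `u` and to `v`.
    refine (hsq A).toIsPushout.hom_ext ?_ ?_
    · rw [reassoc_of% (Stalk.counit_res A i), reassoc_of% (Stalk.counit_res A i), hu]
    · rw [reassoc_of% (Stalk.counit_res A j), reassoc_of% (Stalk.counit_res A j), hv]
  rw [← Stalk.counit_res A k, Category.assoc, Category.assoc, h]

end HasUniversalFiniteJoins

/-- In a distributive lattice, an ideal that misses the top element misses a prime filter. -/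
lemma PrimeFilter.exists_disjoint {P : Type u} [DistribLattice P] [OrderTop P]
    (I : Order.Ideal P) (hI : ⊤ ∉ I) : ∃ x : PrimeFilter P, ∀ a ∈ x.filter, a ∉ I := by
  -- The filter to be separated from `I` is `{⊤}`; the complement of the resulting prime ideal `J`
  -- is the prime filter.
  obtain ⟨J, hJ, hIJ, hdisj⟩ := DistribLattice.prime_ideal_of_disjoint_filter_ideal
    (F := Order.PFilter.principal (⊤ : P)) (I := I)
    (Set.disjoint_left.2 fun a ha ha' => hI (by
      rwa [top_le_iff.1 (Order.PFilter.mem_principal.1 ha)] at ha'))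
  refine ⟨⟨hJ.compl_filter.toPFilter, ?_, ?_⟩, fun a ha ha' => ha (hIJ ha')⟩
  · obtain ⟨a, ha⟩ := J.nonempty
    exact ⟨a, fun h => h ha⟩
  · intro a b c hc hmem
    by_contra! h
    refine hmem ?_
    rw [hc.unique isLUB_pair]
    exact J.sup_mem (not_not.1 h.1) (not_not.1 h.2)

/-- Phrasing the ideal as a predicate closed under `IsLUB` keeps the lattice structure, which
depends on chosen joins, out of the applications. -/
lemma HasUniversalFiniteJoins.exists_primeFilter (hC : HasUniversalFiniteJoins C)
    (p : ZI C → Prop) (hp : ∃ a, p a) (hle : ∀ a b, a ≤ b → p b → p a)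
    (hsup : ∀ a b c, IsLUB {a, b} c → p a → p b → p c) (htop : ¬ p ⊤) :
    ∃ x : PrimeFilter (ZI C), ∀ a ∈ x.filter, ¬ p a := by
  let := hC.distribLattice
  refine PrimeFilter.exists_disjoint
    { carrier := {a | p a}
      lower' := fun a b h ha => hle b a h ha
      nonempty' := hp
      directed' := fun a ha b hb =>
        ⟨a ⊔ b, hsup a b _ isLUB_pair ha hb, le_sup_left, le_sup_right⟩ } htop

/-! ### Faithfulness and injectivity on objects of the functor to the stalks. -/

namespace Stalk

variable {x : Order.PFilter (ZI C)}

/-- The only morphism from `w` to the unit idempotent is `w.hom`, so the two restrictions in the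
germ relation coincide. -/
lemma map_eq_map_iff {A B : C} {f g : A ⟶ B} : (toStalk x).map f = (toStalk x).map g ↔
    ∃ w : CentralIdempotent C, w.toZI ∈ x ∧ counit A w ≫ f = counit A w ≫ g := by
  constructor
  · intro h
    obtain ⟨w, hw, m, n, e⟩ := Quotient.exact h
    refine ⟨w, hw, ?_⟩
    have hm : m.hom = w.hom := (Category.comp_id _).symm.trans m.fac
    have hn : n.hom = w.hom := (Category.comp_id _).symm.trans n.fac
    rw [counit, Category.assoc, Category.assoc, ← hm]
    refine Eq.trans ?_ (e.trans ?_)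
    · rfl
    · rw [hn, ← hm]
  · rintro ⟨w, hw, h⟩
    refine germ_eq hw w.toUnit w.toUnit ?_
    change A ◁ w.hom ≫ (ρ_ A).hom ≫ f = A ◁ w.hom ≫ (ρ_ A).hom ≫ g
    simpa [counit] using h

end Stalk

namespace HasUniversalFiniteJoins

lemma faithful_toStalks (hC : HasUniversalFiniteJoins C) : (toStalks C).Faithful := by
  refine ⟨fun {A B f g} h => ?_⟩
  by_contra hne
  let p (a : ZI C) : Prop := ∃ u : CentralIdempotent C, u.toZI = a ∧
    Stalk.counit A u ≫ f = Stalk.counit A u ≫ g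
  have hle {u v : CentralIdempotent C} (huv : u.toZI ≤ v.toZI)
      (hv : Stalk.counit A v ≫ f = Stalk.counit A v ≫ g) :
      Stalk.counit A u ≫ f = Stalk.counit A u ≫ g := by
    obtain ⟨m⟩ := huv
    rw [← Stalk.counit_res A m, Category.assoc, Category.assoc, hv]
  obtain ⟨z, ⟨hz⟩⟩ := exists_obj_isInitial hC.exists_zero
  obtain ⟨Z, ⟨hZ⟩, hZ'⟩ := hC.exists_zero
  -- Any two morphisms agree on the zero idempotent, so the ideal `p` is nonempty.
  have hAz : Limits.IsInitial (A ⊗ z.obj) :=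
    hZ.ofIso ((hZ' A).1.some.symm ≪≫ whiskerLeftIso A (hZ.uniqueUpToIso hz))
  obtain ⟨x, hx⟩ := hC.exists_primeFilter p ⟨z.toZI, z, rfl, hAz.hom_ext _ _⟩
    (fun a b hab ⟨v, hv, e⟩ => by
      obtain ⟨u, rfl⟩ := exists_toZI_eq a
      exact ⟨u, rfl, hle (hab.trans_eq hv.symm) e⟩)
    (fun a b c hc ⟨u, hu, e⟩ ⟨v, hv, e'⟩ => by
      obtain ⟨w, rfl⟩ := exists_toZI_eq c
      subst hu hv
      exact ⟨w, rfl, hC.counit_comp_eq_of_isLUB hc e e'⟩)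
    -- Agreement on `⊤` is agreement after restriction along `𝟙 (𝟙_ C)`, which is `f = g`.
    (fun ⟨u, hu, e⟩ => hne (by
      have h₁ := hle (u := unit) hu.ge e
      simpa [Stalk.counit] using h₁))
  obtain ⟨w, hw, e⟩ := Stalk.map_eq_map_iff.1 (congrFun h x)
  exact hx _ hw ⟨w, rfl, e⟩

/-- Each component is the identity on objects, so it suffices that one prime filter exists; it is
found by separating the principal ideal of the zero idempotent from `⊤`. -/
lemma injective_toStalks_obj (hC : HasUniversalFiniteJoins C) [Nontrivial (ZI C)] :
    Function.Injective (toStalks C).obj := by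
  intro A B h
  obtain ⟨z, ⟨hz⟩⟩ := exists_obj_isInitial hC.exists_zero
  have hbot := toZI_le_of_isInitial hz
  obtain ⟨x, -⟩ := hC.exists_primeFilter (fun a => a ≤ z.toZI) ⟨_, le_rfl⟩
    (fun _ _ => le_trans) (fun a b c hc ha hb => hc.2 (by rintro _ (rfl | rfl) <;> assumption))
    (fun htop => by
      obtain ⟨a, b, hab⟩ := exists_pair_ne (ZI C)
      have h (c : ZI C) : c = z.toZI := le_antisymm (le_top.trans htop) (hbot c)
      exact hab ((h a).trans (h b).symm))
  exact congrArg Stalk.obj (congrFun h x)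

end HasUniversalFiniteJoins

instance (C : Type u) [Category.{v} C] [MonoidalCategory C] : (toStalks C).Monoidal :=
  inferInstanceAs (Functor.pi' fun x : PrimeFilter (ZI C) => Stalk.toStalk x.filter).Monoidal

end Order

/-! ### Images of central idempotents in a stalk. -/

section StalkLocal

variable {C : Type u} [Category.{v} C] [MonoidalCategory C] {x : Order.PFilter (ZI C)}

open CentralIdempotent

namespace Stalk

/-- The quotient functor sends central idempotents to central idempotents. -/
abbrev mapIdem (x : Order.PFilter (ZI C)) (u : CentralIdempotent C) :
    CentralIdempotent (Stalk x) where
  obj := ⟨u.obj⟩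
  hom := (toStalk x).map u.hom
  braid :=
    { β := fun X => (toStalk x).mapIso (u.braid.β X.obj)
      monoidal := fun X Y => by
        change (toStalk x).map (u.braid.β (X.obj ⊗ Y.obj)).hom =
          (toStalk x).map (α_ u.obj X.obj Y.obj).inv ≫
            whiskerRight ((toStalk x).map (u.braid.β X.obj).hom) Y ≫
            (toStalk x).map (α_ X.obj u.obj Y.obj).hom ≫
            whiskerLeft X ((toStalk x).map (u.braid.β Y.obj).hom) ≫
            (toStalk x).map (α_ X.obj Y.obj u.obj).inv
        rw [whiskerLeft_map, whiskerRight_map, map_comp_map, map_comp_map, map_comp_map,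
          map_comp_map, u.braid.monoidal]
      naturality := fun {X Y} φ => by
        obtain ⟨X⟩ := X
        obtain ⟨Y⟩ := Y
        -- The half-braiding of `u` is natural for morphisms of `C`; for a fraction `φ`, cancel the
        -- invertible denominator `e`.
        obtain ⟨A, e, f, he, hf⟩ := exists_fraction φ
        change whiskerLeft ⟨u.obj⟩ φ ≫ (toStalk x).map (u.braid.β Y).hom =
          (toStalk x).map (u.braid.β X).hom ≫ whiskerRight φ ⟨u.obj⟩
        have := isIso_whiskerLeft ⟨u.obj⟩ ((toStalk x).map e)
        rw [← cancel_epi (whiskerLeft ⟨u.obj⟩ ((toStalk x).map e))]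
        calc _ = whiskerLeft ⟨u.obj⟩ ((toStalk x).map f) ≫ (toStalk x).map (u.braid.β Y).hom := by
              rw [← Category.assoc, ← whiskerLeft_comp, hf]
          _ = (toStalk x).map (u.braid.β A).hom ≫ whiskerRight ((toStalk x).map f) ⟨u.obj⟩ := by
              rw [whiskerLeft_map, whiskerRight_map, map_comp_map, map_comp_map,
                u.braid.naturality]
          _ = ((toStalk x).map (u.braid.β A).hom ≫ whiskerRight ((toStalk x).map e) ⟨u.obj⟩) ≫
                whiskerRight φ ⟨u.obj⟩ := by
              rw [← hf, whiskerRight_comp, Category.assoc]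
          _ = _ := by
              rw [whiskerLeft_map, whiskerRight_map, map_comp_map, ← u.braid.naturality,
                ← map_comp_map, Category.assoc] }
  hom_braid X := by
    change (toStalk x).map (u.braid.β X.obj).hom ≫ whiskerLeft X ((toStalk x).map u.hom) ≫
      (toStalk x).map (ρ_ X.obj).hom =
      whiskerRight ((toStalk x).map u.hom) X ≫ (toStalk x).map (λ_ X.obj).hom
    rw [whiskerLeft_map, whiskerRight_map, map_comp_map, map_comp_map, map_comp_map, u.hom_braid]
  central := by
    change whiskerRight ((toStalk x).map u.hom) ⟨u.obj⟩ ≫ (toStalk x).map (λ_ u.obj).hom =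
      whiskerLeft ⟨u.obj⟩ ((toStalk x).map u.hom) ≫ (toStalk x).map (ρ_ u.obj).hom
    rw [whiskerLeft_map, whiskerRight_map, map_comp_map, map_comp_map, u.central]
  isIso_left := by
    change IsIso (whiskerRight ((toStalk x).map u.hom) ⟨u.obj⟩ ≫ (toStalk x).map (λ_ u.obj).hom)
    rw [whiskerRight_map, map_comp_map]
    have := u.isIso_left
    exact (toStalk x).map_isIso (u.hom ▷ u.obj ≫ (λ_ u.obj).hom)

lemma mapIdem_mono {u v : CentralIdempotent C} (h : u.toZI ≤ v.toZI) :
    (mapIdem x u).toZI ≤ (mapIdem x v).toZI := by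
  obtain ⟨m⟩ := h
  exact (Hom.ofFac ((toStalk x).map m.hom)
    ((map_comp_map _ _).trans (congrArg (toStalk x).map m.fac))).toZI_le

lemma germ_comp_map {A B D : C} (v : CentralIdempotent C) (hv : v.toZI ∈ x)
    (f : A ⊗ v.obj ⟶ B) (g : B ⟶ D) :
    germ (X := ⟨A⟩) (Y := ⟨B⟩) v hv f ≫ (toStalk x).map g =
      germ (X := ⟨A⟩) (Y := ⟨D⟩) v hv (f ≫ g) := by
  rw [germ_eq_germ_comp, germ_eq_germ_comp (f := f ≫ g), Category.assoc, map_comp_map]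

/-- A central idempotent becomes trivial in the stalk at a filter only if it is in the filter. -/
lemma mapIdem_eq_top_iff {u : CentralIdempotent C} : (mapIdem x u).toZI = ⊤ ↔ u.toZI ∈ x := by
  constructor
  · intro h
    obtain ⟨m⟩ : (unit : CentralIdempotent (Stalk x)).toZI ≤ (mapIdem x u).toZI := h.ge
    obtain ⟨φ, hφ, -⟩ := m
    change (⟨𝟙_ C⟩ : Stalk x) ⟶ ⟨u.obj⟩ at φ
    change φ ≫ (toStalk x).map u.hom = 𝟙 (⟨𝟙_ C⟩ : Stalk x) at hφ
    induction φ using ind with | h v hv g =>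
    have h' : germ (X := ⟨𝟙_ C⟩) (Y := ⟨𝟙_ C⟩) v hv (g ≫ u.hom) =
        germ unit (unit_mem x) (ρ_ (𝟙_ C)).hom := (germ_comp_map v hv g u.hom).symm.trans hφ
    -- A section of `u.hom` in the stalk is a germ `g`. On a small enough `w` in the filter it is a
    -- section over the unit in `C`, which says that `w` lies below `u`.
    obtain ⟨w, hw, m, n, e⟩ := Quotient.exact h'
    have hn : n.hom = w.hom := (Category.comp_id _).symm.trans n.fac
    change 𝟙_ C ◁ m.hom ≫ g ≫ u.hom = 𝟙_ C ◁ n.hom ≫ (ρ_ (𝟙_ C)).hom at e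
    refine Order.PFilter.mem_of_le (Hom.ofFac ((λ_ _).inv ≫ 𝟙_ C ◁ m.hom ≫ g) ?_).toZI_le hw
    rw [Category.assoc, Category.assoc, e, hn, ← unitors_equal,
      MonoidalCategory.leftUnitor_naturality, Iso.inv_hom_id_assoc]
  · intro hu
    -- Up to unitors, `u.hom` is the counit at `𝟙_ C`, and counits of idempotents in the filter are
    -- inverted.
    have : IsIso ((toStalk x).map u.hom) := by
      have h := isIso_toStalk_counit (x := x) (𝟙_ C) u hu
      rw [counit, ← unitors_equal, MonoidalCategory.leftUnitor_naturality,
        Functor.map_comp] at h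
      have := (toStalk x).map_isIso (λ_ u.obj).hom
      exact IsIso.of_isIso_comp_left ((toStalk x).map (λ_ u.obj).hom) _
    exact top_le_iff.1 (Hom.ofFac (u := unit) (v := mapIdem x u) (inv ((toStalk x).map u.hom))
      (IsIso.inv_hom_id _)).toZI_le

end Stalk

end StalkLocal

/-! ### Central idempotents of `C` built from data that are idempotent only locally. -/

section Lift

variable {C : Type u} [Category.{v} C] [MonoidalCategory C]

open CentralIdempotent

namespace CentralIdempotent

lemma isIso_counit_whiskerRight (A : C) (w : CentralIdempotent C) :
    IsIso (Stalk.counit A w ▷ w.obj) := by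
  have h : Stalk.counit A w ▷ w.obj =
      (α_ A w.obj w.obj).hom ≫ A ◁ (w.hom ▷ w.obj ≫ (λ_ w.obj).hom) := by
    rw [Stalk.counit]; monoidal
  rw [h]
  infer_instance

/-- Since `w` is idempotent, the counit becomes invertible after tensoring with `w` and can be
cancelled. Local equations on `w` thus become equations between morphisms tensored with `w`. -/
lemma whiskerRight_eq_of_counit_comp_eq {A B : C} {k k' : A ⟶ B} (w : CentralIdempotent C)
    (h : Stalk.counit A w ≫ k = Stalk.counit A w ≫ k') : k ▷ w.obj = k' ▷ w.obj := by
  have := isIso_counit_whiskerRight A w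
  rw [← cancel_epi (Stalk.counit A w ▷ w.obj), ← comp_whiskerRight, h, comp_whiskerRight]

section

variable {A : C} (f : A ⟶ 𝟙_ C) (w : CentralIdempotent C)

/-- The shuffle `(A ⊗ w) ⊗ (A ⊗ w) ≅ (A ⊗ A) ⊗ (w ⊗ w)` given by the half-braiding of `w`. -/
abbrev shuffle (A : C) (w : CentralIdempotent C) :
    (A ⊗ w.obj) ⊗ (A ⊗ w.obj) ≅ (A ⊗ A) ⊗ (w.obj ⊗ w.obj) :=
  α_ A w.obj (A ⊗ w.obj) ≪≫ whiskerLeftIso A ((α_ w.obj A w.obj).symm ≪≫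
    whiskerRightIso (w.braid.β A) w.obj ≪≫ α_ A w.obj w.obj) ≪≫ (α_ A A (w.obj ⊗ w.obj)).symm

/-- This and `whiskerLeft_counit_comp` write the two maps `(A ⊗ w) ⊗ (A ⊗ w) ⟶ A ⊗ w` as one common
isomorphism followed by the corresponding map for `f`, tensored with `w`. Centrality and
invertibility can then be tested on that last factor. -/
lemma counit_comp_whiskerRight :
    (Stalk.counit A w ≫ f) ▷ (A ⊗ w.obj) ≫ (λ_ (A ⊗ w.obj)).hom =
      (shuffle A w).hom ≫ (A ⊗ A) ◁ (w.hom ▷ w.obj ≫ (λ_ w.obj).hom) ≫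
        (f ▷ A ≫ (λ_ A).hom) ▷ w.obj := by
  have h := w.hom_braid A
  simp only [Iso.trans_hom, whiskerLeftIso_hom, whiskerRightIso_hom, Iso.symm_hom]
  calc _ = 𝟙 _ ⊗≫ A ◁ (w.hom ▷ A ≫ (λ_ A).hom) ▷ w.obj ⊗≫ f ▷ A ▷ w.obj ⊗≫ 𝟙 _ := by
        rw [Stalk.counit]; monoidal
    _ = _ := by rw [← h]; monoidal

lemma whiskerLeft_counit_comp :
    (A ⊗ w.obj) ◁ (Stalk.counit A w ≫ f) ≫ (ρ_ (A ⊗ w.obj)).hom =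
      (shuffle A w).hom ≫ (A ⊗ A) ◁ (w.hom ▷ w.obj ≫ (λ_ w.obj).hom) ≫
        (A ◁ f ≫ (ρ_ A).hom) ▷ w.obj := by
  have h := w.hom_braid' f
  simp only [Iso.trans_hom, whiskerLeftIso_hom, whiskerRightIso_hom, Iso.symm_hom]
  rw [w.central]
  calc _ = 𝟙 _ ⊗≫ ((A ⊗ w.obj) ⊗ A) ◁ w.hom ⊗≫ A ◁ (w.obj ◁ f ≫ (ρ_ w.obj).hom) ⊗≫ 𝟙 _ := by
        rw [Stalk.counit]; monoidal
    _ = 𝟙 _ ⊗≫ ((A ⊗ (w.obj ⊗ A)) ◁ w.hom ≫ (A ◁ (w.braid.β A).hom) ▷ 𝟙_ C) ⊗≫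
          A ◁ f ▷ w.obj ⊗≫ 𝟙 _ := by rw [← h]; monoidal
    _ = _ := by rw [whisker_exchange]; monoidal

end

/-- A morphism `f : A ⟶ 𝟙_ C` that is a central idempotent locally on `w` becomes one after
restriction to `w`, provided that the restricted domain has a half-braiding. -/
abbrev ofLocal {A : C} (f : A ⟶ 𝟙_ C) (w : CentralIdempotent C) (g : A ⊗ w.obj ⟶ A ⊗ A)
    (hc : Stalk.counit (A ⊗ A) w ≫ f ▷ A ≫ (λ_ A).hom =
      Stalk.counit (A ⊗ A) w ≫ A ◁ f ≫ (ρ_ A).hom)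
    (hg : g ≫ f ▷ A ≫ (λ_ A).hom = Stalk.counit A w)
    (hg' : (f ▷ A ≫ (λ_ A).hom) ▷ w.obj ≫ g = Stalk.counit (A ⊗ A) w)
    (b : HalfBraiding (A ⊗ w.obj))
    (hb : ∀ B : C, (b.β B).hom ≫ B ◁ (Stalk.counit A w ≫ f) ≫ (ρ_ B).hom =
      (Stalk.counit A w ≫ f) ▷ B ≫ (λ_ B).hom) : CentralIdempotent C where
  obj := A ⊗ w.obj
  hom := Stalk.counit A w ≫ f
  braid := b
  hom_braid := hb
  central := by
    rw [counit_comp_whiskerRight, whiskerLeft_counit_comp, whiskerRight_eq_of_counit_comp_eq w hc]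
  isIso_left := by
    set k := f ▷ A ≫ (λ_ A).hom with hk
    -- After tensoring with `w` the counits in `hg` and `hg'` are invertible, so `g ▷ w.obj` is both
    -- split mono and split epi. It is therefore invertible, and by `h₁` so is `k ▷ w.obj`.
    have h₁ : IsIso (g ▷ w.obj ≫ k ▷ w.obj) := by
      rw [← comp_whiskerRight, hg]
      exact isIso_counit_whiskerRight A w
    have h₂ : IsIso (k ▷ w.obj ▷ w.obj ≫ g ▷ w.obj) := by
      rw [← comp_whiskerRight, hg']
      exact isIso_counit_whiskerRight (A ⊗ A) w
    have h₃ : IsIso (g ▷ w.obj) := by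
      refine ⟨k ▷ w.obj ≫ inv (g ▷ w.obj ≫ k ▷ w.obj), ?_, ?_⟩
      · rw [← Category.assoc, IsIso.hom_inv_id]
      · have : Epi (g ▷ w.obj) := epi_of_epi (k ▷ w.obj ▷ w.obj) (g ▷ w.obj)
        rw [← cancel_epi (g ▷ w.obj)]
        simp only [Category.assoc]
        rw [← Category.assoc, ← Category.assoc, IsIso.hom_inv_id, Category.id_comp,
          Category.comp_id]
    have h₄ : IsIso (k ▷ w.obj) := IsIso.of_isIso_comp_left (g ▷ w.obj) _
    rw [counit_comp_whiskerRight]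
    infer_instance

end CentralIdempotent

end Lift

/-! ### Stalks of braided categories. -/

section BraidedStalk

variable {C : Type u} [Category.{v} C] [MonoidalCategory C]

open CentralIdempotent

namespace CentralIdempotent

/-- With `tensorHom_comp_right`, this transports centrality and invertibility along an isomorphism
`e` without putting a half-braiding on `B`. -/
lemma tensorHom_comp_left {B : C} (u : CentralIdempotent C) (e : B ⟶ u.obj) :
    (e ⊗ₘ e) ≫ u.hom ▷ u.obj ≫ (λ_ u.obj).hom = ((e ≫ u.hom) ▷ B ≫ (λ_ B).hom) ≫ e := by
  rw [tensorHom_def', Category.assoc, ← comp_whiskerRight_assoc, whisker_exchange_assoc,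
    leftUnitor_naturality, Category.assoc]

lemma tensorHom_comp_right {B : C} (u : CentralIdempotent C) (e : B ⟶ u.obj) :
    (e ⊗ₘ e) ≫ u.obj ◁ u.hom ≫ (ρ_ u.obj).hom = (B ◁ (e ≫ u.hom) ≫ (ρ_ B).hom) ≫ e := by
  rw [MonoidalCategory.tensorHom_def, Category.assoc, ← whiskerLeft_comp_assoc,
    ← whisker_exchange_assoc, rightUnitor_naturality, Category.assoc]

lemma central_of_iso {B : C} (u : CentralIdempotent C) (e : B ⟶ u.obj) [IsIso e] :
    (e ≫ u.hom) ▷ B ≫ (λ_ B).hom = B ◁ (e ≫ u.hom) ≫ (ρ_ B).hom := by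
  rw [← cancel_mono e, ← tensorHom_comp_left, ← tensorHom_comp_right, u.central]

lemma isIso_left_of_iso {B : C} (u : CentralIdempotent C) (e : B ⟶ u.obj) [IsIso e] :
    IsIso ((e ≫ u.hom) ▷ B ≫ (λ_ B).hom) := by
  have : IsIso (((e ≫ u.hom) ▷ B ≫ (λ_ B).hom) ≫ e) := by
    rw [← tensorHom_comp_left]
    infer_instance
  exact IsIso.of_isIso_comp_right _ e

end CentralIdempotent

namespace Stalk

variable {x : Order.PFilter (ZI C)}

/-- Morphisms over the unit are unique, so the equation persists on everything below `w`, along any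
restriction map. Several germ equations can thus be realised on one common idempotent. -/
lemma exists_forall_le_of_germ_eq {A B : C} {v : CentralIdempotent C} {hv : v.toZI ∈ x}
    {f g : A ⊗ v.obj ⟶ B} (h : germ (X := ⟨A⟩) (Y := ⟨B⟩) v hv f = germ v hv g) :
    ∃ w : CentralIdempotent C, w.toZI ∈ x ∧ ∀ z : CentralIdempotent C, Nonempty (Hom z w) →
      ∀ m : Hom z v, A ◁ m.hom ≫ f = A ◁ m.hom ≫ g := by
  obtain ⟨w, hw, m, n, e⟩ := Quotient.exact h
  refine ⟨w, hw, fun z ⟨p⟩ q => ?_⟩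
  have h₁ : q.hom = p.hom ≫ m.hom := fac_unique _ _ q.fac (p.comp m).fac
  have h₂ : q.hom = p.hom ≫ n.hom := fac_unique _ _ q.fac (p.comp n).fac
  calc A ◁ q.hom ≫ f = A ◁ p.hom ≫ A ◁ m.hom ≫ f := by
        rw [h₁, MonoidalCategory.whiskerLeft_comp_assoc]
    _ = A ◁ p.hom ≫ A ◁ n.hom ≫ g := congrArg _ e
    _ = A ◁ q.hom ≫ g := by rw [h₂, MonoidalCategory.whiskerLeft_comp_assoc]

lemma map_comp_germ {A B D : C} (k : A ⟶ B) (v : CentralIdempotent C) (hv : v.toZI ∈ x)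
    (g : B ⊗ v.obj ⟶ D) :
    (toStalk x).map k ≫ germ (X := ⟨B⟩) (Y := ⟨D⟩) v hv g =
      germ (X := ⟨A⟩) (Y := ⟨D⟩) v hv (k ▷ v.obj ≫ g) := by
  change germ (unit.tensor v) _ ((α_ A (𝟙_ C) v.obj).inv ≫ ((ρ_ A).hom ≫ k) ▷ v.obj ≫ g) = _
  refine (germ_res _ (unit.tensorSnd v) _ ?_).symm
  change A ◁ (𝟙 (𝟙_ C) ▷ v.obj ≫ (λ_ v.obj).hom) ≫ k ▷ v.obj ≫ g = _
  simp

lemma id_eq_germ_counit (A : C) (v : CentralIdempotent C) (hv : v.toZI ∈ x) :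
    𝟙 (⟨A⟩ : Stalk x) = germ (X := ⟨A⟩) (Y := ⟨A⟩) v hv (counit A v) :=
  germ_res hv v.toUnit _ rfl

/-- In a braided category, every central idempotent of the stalk comes from one of `C`. -/
lemma exists_mapIdem_toZI_eq [BraidedCategory C] (u : CentralIdempotent (Stalk x)) :
    ∃ u₀ : CentralIdempotent C, (mapIdem x u₀).toZI = u.toZI := by
  obtain ⟨A, e, f, he, hf⟩ := exists_fraction u.hom
  let e' : (⟨A⟩ : Stalk x) ⟶ u.obj := (toStalk x).map e
  have he' : IsIso e' := he
  change A ⟶ 𝟙_ C at f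
  change e' ≫ u.hom = (toStalk x).map f at hf
  have hc := u.central_of_iso e'
  have hi := u.isIso_left_of_iso e'
  rw [hf] at hc hi
  set k := f ▷ A ≫ (λ_ A).hom with hk
  have e₁ : (toStalk x).map f ▷ (⟨A⟩ : Stalk x) ≫ (λ_ (⟨A⟩ : Stalk x)).hom =
      (toStalk x).map k := by
    change whiskerRight ((toStalk x).map f) ⟨A⟩ ≫ (toStalk x).map (λ_ A).hom = _
    rw [whiskerRight_map, map_comp_map]
  have e₂ : (⟨A⟩ : Stalk x) ◁ (toStalk x).map f ≫ (ρ_ (⟨A⟩ : Stalk x)).hom =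
      (toStalk x).map (A ◁ f ≫ (ρ_ A).hom) := by
    change whiskerLeft ⟨A⟩ ((toStalk x).map f) ≫ (toStalk x).map (ρ_ A).hom = _
    rw [whiskerLeft_map, map_comp_map]
  rw [e₁] at hi
  obtain ⟨w₁, hw₁, h₁⟩ := map_eq_map_iff.1 (e₁.symm.trans (hc.trans e₂))
  -- The inverse of `k` in the stalk is a germ `g` on `v`, and being inverse amounts to two germ
  -- equations, valid on `w₂` and `w₃`. Centrality already holds on `w₁`.
  obtain ⟨φ, hφ, hφ'⟩ := hi
  change (⟨A⟩ : Stalk x) ⟶ ⟨A ⊗ A⟩ at φ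
  induction φ using ind with | h v hv g =>
  change (toStalk x).map k ≫ germ (X := ⟨A⟩) (Y := ⟨A ⊗ A⟩) v hv g = 𝟙 (⟨A ⊗ A⟩ : Stalk x) at hφ
  change germ (X := ⟨A⟩) (Y := ⟨A ⊗ A⟩) v hv g ≫ (toStalk x).map k = 𝟙 (⟨A⟩ : Stalk x) at hφ'
  rw [map_comp_germ, id_eq_germ_counit _ v hv] at hφ
  rw [germ_comp_map, id_eq_germ_counit _ v hv] at hφ'
  obtain ⟨w₂, hw₂, h₂⟩ := exists_forall_le_of_germ_eq hφ
  obtain ⟨w₃, hw₃, h₃⟩ := exists_forall_le_of_germ_eq hφ'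
  -- On this meet `g` is defined and all three equations hold in `C`.
  let z := (w₁.tensor v).tensor (w₂.tensor w₃)
  have hz : z.toZI ∈ x := tensor_mem (tensor_mem hw₁ hv) (tensor_mem hw₂ hw₃)
  let m₁ : Hom z w₁ := (tensorFst _ _).comp (tensorFst _ _)
  let m : Hom z v := (tensorFst _ _).comp (tensorSnd _ _)
  replace h₂ := h₂ z ⟨(tensorSnd _ _).comp (tensorFst _ _)⟩ m
  replace h₃ := h₃ z ⟨(tensorSnd _ _).comp (tensorSnd _ _)⟩ m
  rw [counit_res] at h₂ h₃
  -- Here the braiding enters: it supplies the half-braiding on `A ⊗ z`, over which every morphism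
  -- to the unit is central by naturality.
  have hb (B : C) : (β_ (A ⊗ z.obj) B).hom ≫ B ◁ (counit A z ≫ f) ≫ (ρ_ B).hom =
      (counit A z ≫ f) ▷ B ≫ (λ_ B).hom := by
    rw [← BraidedCategory.braiding_naturality_left_assoc, braiding_rightUnitor]
  let u₀ : CentralIdempotent C := ofLocal f z (A ◁ m.hom ≫ g)
    (by rw [← counit_res _ m₁, Category.assoc, Category.assoc, h₁])
    (by rw [Category.assoc, h₃])
    (by rw [← whisker_exchange_assoc, h₂])
    (Center.ofBraidedObj (A ⊗ z.obj)).2 hb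
  have hiso := isIso_toStalk_counit A z hz
  -- Both factors are invertible in the stalk. As `p` lies over the unit, it respects the
  -- half-braidings, although that of `u₀` was not built from that of `u`.
  let p : (mapIdem x u₀).obj ⟶ u.obj := (toStalk x).map (counit A z) ≫ e'
  have hp : IsIso p := inferInstanceAs (IsIso ((toStalk x).map (counit A z) ≫ e'))
  have hpu : p ≫ u.hom = (mapIdem x u₀).hom := by
    change (_ ≫ e') ≫ u.hom = (toStalk x).map (counit A z ≫ f)
    rw [Category.assoc, hf, map_comp_map]
  exact ⟨u₀, le_antisymm (Hom.ofFac p hpu).toZI_le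
    (Hom.ofFac (inv p) (by rw [IsIso.inv_comp_eq, hpu])).toZI_le⟩

end Stalk

/-- The stalks of a braided category at prime filters are `∨`-local. -/
lemma HasUniversalFiniteJoins.isVeeLocal_stalk [BraidedCategory C]
    (hC : HasUniversalFiniteJoins C) (x : PrimeFilter (ZI C)) :
    IsVeeLocal (Stalk x.filter) := by
  constructor
  · obtain ⟨z, ⟨hz⟩⟩ := exists_obj_isInitial hC.exists_zero
    refine ⟨(Stalk.mapIdem x.filter z).toZI, ⊤, fun h => ?_⟩
    obtain ⟨a, ha⟩ := x.proper
    exact ha (Order.PFilter.mem_of_le (toZI_le_of_isInitial hz a) (Stalk.mapIdem_eq_top_iff.1 h))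
  · intro a b hab
    obtain ⟨p, rfl⟩ := exists_toZI_eq a
    obtain ⟨q, rfl⟩ := exists_toZI_eq b
    obtain ⟨u, hu⟩ := Stalk.exists_mapIdem_toZI_eq p
    obtain ⟨v, hv⟩ := Stalk.exists_mapIdem_toZI_eq q
    rw [← hu, ← hv] at hab ⊢
    -- The quotient functor need not be known to preserve joins: the image of `w` is an upper bound
    -- of the two images, whose join is `⊤`.
    obtain ⟨w, i, j, hw, -⟩ := hC.exists_join u v
    have htop : (Stalk.mapIdem x.filter w).toZI = ⊤ := by
      refine top_le_iff.1 (hab.2 ?_)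
      rintro _ (rfl | rfl)
      exacts [Stalk.mapIdem_mono i.toZI_le, Stalk.mapIdem_mono j.toZI_le]
    rw [Stalk.mapIdem_eq_top_iff, Stalk.mapIdem_eq_top_iff]
    exact x.prime _ _ _ hw (Stalk.mapIdem_eq_top_iff.1 htop)

end BraidedStalk

/-! ### Embedding a monoidal category into a `∨`-local category of endofunctors. -/

section Envelope

/-- A zero-preserving endofunctor of the category obtained from `C` by adjoining a strict initial
object, labelled by an object of `C`. -/
structure PointedEndofunctor (C : Type u) [Category.{v} C] : Type (max u v) where
  functor : WithInitial C ⥤ WithInitial C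
  obj_star : functor.obj .star = .star
  label : C

namespace PointedEndofunctor

open CentralIdempotent Limits

variable {C : Type u} [Category.{v} C]

/-- Morphisms are natural transformations; they ignore the labels. -/
@[ext]
structure Hom (F G : PointedEndofunctor C) : Type (max u v) where
  natTrans : F.functor ⟶ G.functor

@[simps]
instance : Category.{max u v} (PointedEndofunctor C) where
  Hom := Hom
  id F := ⟨𝟙 F.functor⟩
  comp φ ψ := ⟨φ.natTrans ≫ ψ.natTrans⟩

@[ext]
lemma hom_ext {F G : PointedEndofunctor C} {φ ψ : F ⟶ G}
    (h : ∀ X, φ.natTrans.app X = ψ.natTrans.app X) : φ = ψ :=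
  Hom.ext (NatTrans.ext (funext h))

@[simps]
def isoMk {F G : PointedEndofunctor C} (e : F.functor ≅ G.functor) : F ≅ G where
  hom := ⟨e.hom⟩
  inv := ⟨e.inv⟩

lemma isIso_app {F G : PointedEndofunctor C} (e : F ≅ G) (X : WithInitial C) :
    IsIso (e.hom.natTrans.app X) :=
  ⟨e.inv.natTrans.app X, congrArg (fun φ => φ.natTrans.app X) e.hom_inv_id,
    congrArg (fun φ => φ.natTrans.app X) e.inv_hom_id⟩

lemma isIso_of_isIso_app {F G : PointedEndofunctor C} (φ : F ⟶ G)
    (h : ∀ X, IsIso (φ.natTrans.app X)) : IsIso φ := by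
  have : IsIso φ.natTrans := NatIso.isIso_of_isIso_app _
  exact (isoMk (asIso φ.natTrans)).isIso_hom

/-- A functor with constant value the adjoined object is initial. -/
def isInitialOfObj {F : PointedEndofunctor C} (h : ∀ X, F.functor.obj X = .star) : IsInitial F :=
  have hF (X : WithInitial C) : IsInitial (F.functor.obj X) :=
    WithInitial.starInitial.ofIso (eqToIso (h X).symm)
  .ofUniqueHom
    (fun _ => ⟨{ app := fun X => (hF X).to _, naturality := fun X _ _ => (hF X).hom_ext _ _ }⟩)
    (fun _ _ => hom_ext fun X => (hF X).hom_ext _ _)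

variable [MonoidalCategory C]

/-- The tensor product composes functors and tensors the labels. -/
@[simps]
instance : MonoidalCategoryStruct (PointedEndofunctor C) where
  tensorObj F G :=
    ⟨F.functor ⋙ G.functor, by simp [F.obj_star, G.obj_star], F.label ⊗ G.label⟩
  whiskerLeft F _ _ φ := ⟨Functor.whiskerLeft F.functor φ.natTrans⟩
  whiskerRight φ F := ⟨Functor.whiskerRight φ.natTrans F.functor⟩
  tensorHom φ ψ := ⟨φ.natTrans ◫ ψ.natTrans⟩
  tensorUnit := ⟨𝟭 _, rfl, 𝟙_ C⟩
  associator F G H := isoMk (Functor.associator F.functor G.functor H.functor)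
  leftUnitor F := isoMk F.functor.leftUnitor
  rightUnitor F := isoMk F.functor.rightUnitor

instance : MonoidalCategory (PointedEndofunctor C) where

/-- The functor with constant value the adjoined object. -/
abbrev zero : PointedEndofunctor C := ⟨(Functor.const _).obj .star, rfl, 𝟙_ C⟩

variable (C) in
-- In `F ⊗ Z` the constant functor is applied last; in `Z ⊗ F` the functor `F` is evaluated at the
-- adjoined object, which it fixes by `obj_star`.
lemma exists_zero : ∃ Z : PointedEndofunctor C, Nonempty (IsInitial Z) ∧
    ∀ F : PointedEndofunctor C, Nonempty (F ⊗ Z ≅ Z) ∧ Nonempty (Z ⊗ F ≅ Z) := by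
  have hZ : IsInitial (zero : PointedEndofunctor C) := isInitialOfObj fun _ => rfl
  refine ⟨_, ⟨hZ⟩, fun F => ⟨⟨?_⟩, ⟨?_⟩⟩⟩
  · exact (isInitialOfObj fun _ => rfl).uniqueUpToIso hZ
  · exact (isInitialOfObj fun _ => F.obj_star).uniqueUpToIso hZ

/-- The functor that is constant on `C` with value `X`. -/
abbrev const (X : C) : PointedEndofunctor C :=
  ⟨WithInitial.map ((Functor.const C).obj X), rfl, 𝟙_ C⟩

/-- No morphism leads from an object of `C` to the adjoined object, so `f` lies in `C` and is sent
to the identity of `X`. -/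
lemma isIso_const_map (X : C) {Y Y' : WithInitial C} (f : Y ⟶ Y') (hY : Y ≠ .star) :
    IsIso ((const X).functor.map f) := by
  cases Y with
  | star => exact absurd rfl hY
  | of Y =>
    cases Y' with
    | star => exact (WithInitial.false_of_to_star f).elim
    | of Y' => exact inferInstanceAs (IsIso (𝟙 (WithInitial.of X)))

/-- Every central idempotent of the category of labelled endofunctors is either invertible or
has initial domain: it commutes with the constant functors. -/
lemma isIso_hom_or_isInitial (u : CentralIdempotent (PointedEndofunctor C)) :
    IsIso u.hom ∨ Nonempty (IsInitial u.obj) := by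
  by_cases h : ∀ X, u.obj.functor.obj X = .star
  · exact .inr ⟨isInitialOfObj h⟩
  · obtain ⟨B, hB⟩ := not_forall.1 h
    refine .inl (isIso_of_isIso_app _ fun X => ?_)
    cases X with
    | star =>
      exact isIso_of_isInitial (WithInitial.starInitial.ofIso (eqToIso u.obj.obj_star.symm))
        WithInitial.starInitial _
    | of X =>
      -- At `B`, the half-braiding with `const X` identifies the component of `u.hom` at `X` with
      -- the image under `const X` of its component at `B`. The latter is invertible because `u.obj`
      -- does not send `B` to the adjoined object. One such `B` serves every `X`.
      have hb := congrArg (fun φ => φ.natTrans.app B) (u.hom_braid (const X))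
      have hc := isIso_const_map X (u.hom.natTrans.app B) hB
      cases B with
      | star => exact absurd u.obj.obj_star hB
      | of B =>
        change (u.braid.β (const X)).hom.natTrans.app (.of B) ≫ u.hom.natTrans.app (.of X) ≫ 𝟙 _ =
          (const X).functor.map (u.hom.natTrans.app (.of B)) ≫ 𝟙 _ at hb
        have := isIso_app (u.braid.β (const X)) (.of B)
        rw [← (congrArg (_ ≫ ·) (Category.comp_id _).symm).trans
          (hb.trans (Category.comp_id _))] at hc
        exact @IsIso.of_isIso_comp_left _ _ _ _ _ _ (u.hom.natTrans.app (.of X)) this hc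

/-- The category of labelled endofunctors has exactly two central idempotents. -/
lemma isVeeLocal : IsVeeLocal (PointedEndofunctor C) := by
  obtain ⟨z, ⟨hz⟩⟩ := exists_obj_isInitial (exists_zero C)
  have hne : z.toZI ≠ ⊤ := by
    intro h
    obtain ⟨m⟩ : (unit : CentralIdempotent (PointedEndofunctor C)).toZI ≤ z.toZI := h.ge
    -- If `z` were the top, the identity functor would map to `zero`; at `𝟙_ C` this is a morphism
    -- from an object of `C` to the adjoined object.
    exact WithInitial.false_of_to_star ((m.hom ≫ hz.to zero).natTrans.app (.of (𝟙_ C)))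
  have htop (a : ZI (PointedEndofunctor C)) : a = ⊤ ∨ a ≤ z.toZI := by
    obtain ⟨u, rfl⟩ := exists_toZI_eq a
    obtain h | ⟨⟨h⟩⟩ := isIso_hom_or_isInitial u
    · exact .inl (top_le_iff.1
        (Hom.ofFac (u := unit) (v := u) (inv u.hom) (IsIso.inv_hom_id _)).toZI_le)
    · exact .inr (toZI_le_of_isInitial h _)
  refine ⟨⟨_, _, hne⟩, fun a b hab => ?_⟩
  by_contra! h
  refine hne (top_le_iff.1 (hab.2 ?_))
  rintro _ (rfl | rfl)
  exacts [(htop _).resolve_left h.1, (htop _).resolve_left h.2]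

/-- Adjoining an initial object to a natural isomorphism. -/
abbrev mapIso₂ {F G : C ⥤ C} (e : F ≅ G) : WithInitial.map F ≅ WithInitial.map G where
  hom := WithInitial.map₂ e.hom
  inv := WithInitial.map₂ e.inv
  hom_inv_id := by
    ext X
    cases X with
    | star => rfl
    | of X => exact e.hom_inv_id_app X
  inv_hom_id := by
    ext X
    cases X with
    | star => rfl
    | of X => exact e.inv_hom_id_app X

variable (C) in
/-- An object of `C` acts by tensoring on the right. -/
abbrev tensoring : C ⥤ PointedEndofunctor C where
  obj A := ⟨WithInitial.map ((tensoringRight C).obj A), rfl, A⟩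
  map f := ⟨WithInitial.map₂ ((tensoringRight C).map f)⟩
  map_id A := by
    ext X
    cases X with
    | star => rfl
    | of X => exact whiskerLeft_id X A
  map_comp f g := by
    ext X
    cases X with
    | star => rfl
    | of X => exact whiskerLeft_comp X f g

/-- Evaluating at the tensor unit recovers a morphism up to unitors. -/
instance : (tensoring C).Faithful where
  map_injective {A B f g} h := by
    have h' : 𝟙_ C ◁ f = 𝟙_ C ◁ g := congrArg (fun φ => φ.natTrans.app (.of (𝟙_ C))) h
    exact (whiskerLeft_iff f g).1 h'

lemma injective_tensoring_obj : Function.Injective (tensoring C).obj :=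
  fun _ _ h => congrArg label h

/-- The product of endofunctors applies the left factor first, which matches tensoring on the right,
so the structure maps are associators and right unitors of `C`. -/
instance : (tensoring C).Monoidal :=
  Functor.CoreMonoidal.toMonoidal
    { εIso := isoMk ((WithInitial.mapId C).symm ≪≫ mapIso₂ (rightUnitorNatIso C).symm)
      μIso := fun A B => isoMk ((WithInitial.mapComp _ _).symm ≪≫
        mapIso₂ (NatIso.ofComponents (fun X => α_ X A B)))
      μIso_hom_natural_left := fun f Z => by
        ext X
        cases X with
        | star => rfl
        | of X =>
          -- The identity factors are the components of `WithInitial.mapComp`; keeping them makes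
          -- the statement definitionally equal to the goal. The identities below play the same
          -- role.
          have h : (X ◁ f) ▷ Z ≫ 𝟙 _ ≫ (α_ X _ Z).hom = (𝟙 _ ≫ (α_ X _ Z).hom) ≫ X ◁ f ▷ Z := by simp
          exact h
      μIso_hom_natural_right := fun Z f => by
        ext X
        cases X with
        | star => rfl
        | of X =>
          have h : (X ⊗ Z) ◁ f ≫ 𝟙 _ ≫ (α_ X Z _).hom = (𝟙 _ ≫ (α_ X Z _).hom) ≫ X ◁ Z ◁ f := by simp
          exact h
      associativity := fun X Y Z => by
        ext W
        cases W with
        | star => rfl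
        | of W =>
          have h : (𝟙 _ ≫ (α_ W X Y).hom) ▷ Z ≫ (𝟙 _ ≫ (α_ W (X ⊗ Y) Z).hom) ≫ W ◁ (α_ X Y Z).hom =
              𝟙 _ ≫ (𝟙 _ ≫ (α_ (W ⊗ X) Y Z).hom) ≫ 𝟙 _ ≫ (α_ W X (Y ⊗ Z)).hom := by simp
          exact h
      left_unitality := fun X => by
        ext W
        cases W with
        | star => rfl
        | of W =>
          have h : 𝟙 (W ⊗ X) = (𝟙 _ ≫ (ρ_ W).inv) ▷ X ≫ (𝟙 _ ≫ (α_ W (𝟙_ C) X).hom) ≫ W ◁ (λ_ X).hom := by simp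
          exact h
      right_unitality := fun X => by
        ext W
        cases W with
        | star => rfl
        | of W =>
          have h : 𝟙 (W ⊗ X) = (𝟙 _ ≫ (ρ_ (W ⊗ X)).inv) ≫ (𝟙 _ ≫ (α_ W X (𝟙_ C)).hom) ≫ W ◁ (ρ_ X).hom := by simp
          exact h }

end PointedEndofunctor

/-- Every monoidal category embeds into a `∨`-local one: the action on itself by tensoring is
faithful, the labels make it injective on objects, and commuting with the constant functors leaves
only two central idempotents. In particular no joins are needed here. -/
lemma exists_embedding_isVeeLocal (C : Type u) [Category.{v} C] [MonoidalCategory C] :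
    ∃ (ι : Type (max u v)) (D : ι → Type (max u v)) (_ : ∀ i, Category.{max u v} (D i))
      (_ : ∀ i, MonoidalCategory (D i)) (F : C ⥤ (∀ i, D i)),
      (∀ i, IsVeeLocal (D i)) ∧ Nonempty F.Monoidal ∧ F.Faithful ∧ Function.Injective F.obj :=
  ⟨PUnit, fun _ => PointedEndofunctor C, fun _ => inferInstance, fun _ => inferInstance,
    Functor.pi' fun _ => PointedEndofunctor.tensoring C,
    fun _ => PointedEndofunctor.isVeeLocal, ⟨inferInstance⟩,
    ⟨fun h => (PointedEndofunctor.tensoring C).map_injective (congrFun h PUnit.unit)⟩,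
    fun _ _ h => PointedEndofunctor.injective_tensoring_obj (congrFun h PUnit.unit)⟩

end Envelope

theorem mainTheorem6 (C : Type u) [Category.{v} C] [MonoidalCategory C]
    (hC : HasUniversalFiniteJoins C) :
    (Nonempty (toStalks C).Monoidal ∧ (toStalks C).Faithful ∧
      (Nontrivial (ZI C) → Function.Injective (toStalks C).obj)) ∧
    (BraidedCategory C → ∀ x : PrimeFilter (ZI C), IsVeeLocal (Stalk x.filter)) ∧
    (∃ (ι : Type (max u v)) (D : ι → Type (max u v)) (_ : ∀ i, Category.{max u v} (D i))
      (_ : ∀ i, MonoidalCategory (D i)) (F : C ⥤ (∀ i, D i)),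
      (∀ i, IsVeeLocal (D i)) ∧ Nonempty F.Monoidal ∧ F.Faithful ∧
        Function.Injective F.obj) := by
  refine ⟨⟨⟨inferInstance⟩, hC.faithful_toStalks, fun _ => hC.injective_toStalks_obj⟩,
    fun _ => hC.isVeeLocal_stalk, exists_embedding_isVeeLocal C⟩
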